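/- Let $\mathbb C$ be a pretopos, i.e. a category that is Barr-exact (regular, and every internal equivalence relation is a kernel pair), has finite coproducts and is extensive. Let $\mathsf{PreOrd}(\mathbb C)$ be the category of internal preorders $(A,\rho)$ in $\mathbb C$ (reflexive and transitive relations $\rho\rightarrowtail A\times A$) and order-preserving morphisms. Let $\mathsf{Eq}(\mathbb C)$ and $\mathsf{ParOrd}(\mathbb C)$ be its full subcategories of equivalence relations ($\rho$ symmetric) and of partial orders ($\rho\cap\rho^{\circ}=\Delta_A$), and let $\mathcal Z=\mathsf{Eq}(\mathbb C)\cap\mathsf{ParOrd}(\mathbb C)$. A morphism is *trivial* if it factors through an object of $\mathcal Z$; $\mathcal Z$-kernels, $\mathcal Z$-cokernels and short $\mathcal Z$-exact sequences are defined as kernels, cokernels and short exact sequences, with trivial morphisms in place of zero morphisms. A pair $(\mathcal T,\mathcal F)$ of replete full subcategories is a *pretorsion theory* if every morphism from $\mathcal T$ to $\mathcal F$ factors through $\mathcal T\cap\mathcal F$ and every object $X$ has a short $(\mathcal T\cap\mathcal F)$-exact sequence $T(X)\to X\to F(X)$ with $T(X)\in\mathcal T$, $F(X)\in\mathcal F$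 (the canonical sequence of $X$, unique up to isomorphism). In a pointed category, $(\mathcal T,\mathcal F)$ is a *torsion theory* if every morphism from $\mathcal T$ to $\mathcal F$ is zero and every object $X$ has a short exact sequence $0\to T(X)\to X\to F(X)\to 0$ (each map the kernel, respectively cokernel, of the other) with $T(X)\in\mathcal T$, $F(X)\in\mathcal F$. A functor from a category with a pretorsion theory $(\mathcal T,\mathcal F)$ to a pointed category with a torsion theory $(\mathcal T',\mathcal F')$ is a *torsion theory functor* if it maps $\mathcal T$ into $\mathcal T'$, $\mathcal F$ into $\mathcal F'$, and canonical sequences to short exact sequences. A subobject $A'\rightarrowtail A$ is *complemented* if there is a subobject $A'^c\rightarrowtail A$ with $A'\cap A'^c=0$ and $A'\cup A'^c=A$. Let $\mathsf{PaPreOrd}(\mathbb C)$ have the objects of $\mathsf{PreOrd}(\mathbb C)$ and, as morphisms $A\to B$, the pairs $(\alpha,f)$, up to isomorphism of representatives, where $\alpha\colon A'\rightarrowtail A$ is a complemented subobject and $f\colon A'\to B$ a morphism in $\mathsf{PreOrd}(\mathbb C)$; composition is by pullback. Two parallel morphisms $(\alpha_1,f_1),(\alpha_2,f_2)\colon A\to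 B$, with domains $A_1,A_2$, are equivalent if there are complemented subobjects $\alpha_0^i\colon A_0\rightarrowtail A_i$ ($i=1,2$) with $\alpha_1\alpha_0^1=\alpha_2\alpha_0^2$ a complemented subobject of $A$, such that $f_1\alpha_0^1=f_2\alpha_0^2$ and $f_i$ is trivial on the complement of $A_0$ in $A_i$ for $i=1,2$. The *stable category* $\mathsf{Stab}(\mathbb C)$ is the quotient of $\mathsf{PaPreOrd}(\mathbb C)$ by this congruence, and $\Sigma\colon\mathsf{PreOrd}(\mathbb C)\to\mathsf{Stab}(\mathbb C)$ is the functor that is the identity on objects and sends $f$ to the class of $(1,f)$. **Theorem.** The pair $(\mathsf{Eq}(\mathbb C),\mathsf{ParOrd}(\mathbb C))$ is a pretorsion theory in $\mathsf{PreOrd}(\mathbb C)$; the category $\mathsf{Stab}(\mathbb C)$ is pointed, has finite coproducts, and the same two classes of objects form a torsion theory in it; $\Sigma$ is a torsion theory functor that preserves finite coproducts. Moreover $\Sigma$ is universal with this property: for every pointed category $\mathbb X$ with finite coproducts and a torsion theory $(\mathcal T,\mathcal F)$, and every torsion theory functor $G\colon\mathsf{PreOrd}(\mathbb C)\to\mathbb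 X$ that preserves finite coproducts, there is a unique functor $\overline G\colon\mathsf{Stab}(\mathbb C)\to\mathbb X$ with $\overline G\circ\Sigma=G$; and $\overline G$ preserves finite coproducts and is a torsion theory functor. -/

import Mathlib

open CategoryTheory CategoryTheory.Limits

universe v u v₁ u₁ v₂ u₂

set_option linter.unusedSectionVars false
set_option linter.unusedVariables false

attribute [-instance] CategoryTheory.catToReflQuiver

/-! ### Ideals of trivial morphisms, pretorsion theories, torsion theories -/

section PretorsionTheories

variable {A : Type u₁} [Category.{v₁} A]

/-- A morphism is `Z`-trivial if it factors through an object of `Z`. -/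
def IsTrivialMor (Z : ObjectProperty A) {X Y : A} (f : X ⟶ Y) : Prop :=
  ∃ (W : A) (a : X ⟶ W) (b : W ⟶ Y), Z W ∧ a ≫ b = f

/-- `k` is a `Z`-kernel of `f`. -/
def IsZKernel (Z : ObjectProperty A) {K X Y : A} (k : K ⟶ X) (f : X ⟶ Y) : Prop :=
  IsTrivialMor Z (k ≫ f) ∧
    ∀ ⦃W : A⦄ (l : W ⟶ X), IsTrivialMor Z (l ≫ f) → ∃! l' : W ⟶ K, l' ≫ k = l

/-- `q` is a `Z`-cokernel of `f`. -/
def IsZCokernel (Z : ObjectProperty A) {X Y Q : A} (f : X ⟶ Y) (q : Y ⟶ Q) : Prop :=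
  IsTrivialMor Z (f ≫ q) ∧
    ∀ ⦃W : A⦄ (l : Y ⟶ W), IsTrivialMor Z (f ≫ l) → ∃! l' : Q ⟶ W, q ≫ l' = l

/-- `X ⟶ Y ⟶ W` is a short `Z`-exact sequence. -/
def IsShortZExact (Z : ObjectProperty A) {X Y W : A} (f : X ⟶ Y) (g : Y ⟶ W) : Prop :=
  IsZKernel Z f g ∧ IsZCokernel Z f g

/-- A pretorsion theory `(T, F)`: two replete full subcategories (given by their classes of
objects), with trivial objects those in `T ⊓ F`. -/
structure IsPretorsionTheory (T F : ObjectProperty A) : Prop where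
  replete_torsion : T.IsClosedUnderIsomorphisms
  replete_torsionFree : F.IsClosedUnderIsomorphisms
  trivial : ∀ ⦃X Y : A⦄ (f : X ⟶ Y), T X → F Y → IsTrivialMor (T ⊓ F) f
  exact_seq : ∀ X : A, ∃ (X₁ X₂ : A) (f : X₁ ⟶ X) (g : X ⟶ X₂),
    T X₁ ∧ F X₂ ∧ IsShortZExact (T ⊓ F) f g

/-- `0 ⟶ X ⟶ Y ⟶ W ⟶ 0` is a short exact sequence in a category with zero morphisms: `f` is a
kernel of `g` and `g` is a cokernel of `f`. -/
def IsShortExactSeq [HasZeroMorphisms A] {X Y W : A} (f : X ⟶ Y) (g : Y ⟶ W) : Prop :=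
  ∃ w : f ≫ g = 0, Nonempty (IsLimit (KernelFork.ofι f w)) ∧
    Nonempty (IsColimit (CokernelCofork.ofπ g w))

/-- A torsion theory `(T, F)` in a pointed category. -/
structure IsTorsionTheory [HasZeroObject A] [HasZeroMorphisms A] (T F : ObjectProperty A) :
    Prop where
  replete_torsion : T.IsClosedUnderIsomorphisms
  replete_torsionFree : F.IsClosedUnderIsomorphisms
  zero : ∀ ⦃X Y : A⦄ (f : X ⟶ Y), T X → F Y → f = 0
  exact_seq : ∀ X : A, ∃ (X₁ X₂ : A) (f : X₁ ⟶ X) (g : X ⟶ X₂),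
    T X₁ ∧ F X₂ ∧ IsShortExactSeq f g

/-- A torsion theory functor from a category with a pretorsion theory `(T, F)` to a pointed
category with a torsion theory `(T', F')`. The canonical short `Z`-exact sequence of an object is
determined up to isomorphism as the one with left end in `T` and right end in `F`. -/
structure IsTorsionTheoryFunctor {B : Type u₂} [Category.{v₂} B] [HasZeroMorphisms B]
    (T F : ObjectProperty A) (T' F' : ObjectProperty B) (G : A ⥤ B) : Prop where
  map_torsion : ∀ X, T X → T' (G.obj X)
  map_torsionFree : ∀ X, F X → F' (G.obj X)
  map_exact : ∀ ⦃X₁ X X₂ : A⦄ (f : X₁ ⟶ X) (g : X ⟶ X₂), T X₁ → F X₂ →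
    IsShortZExact (T ⊓ F) f g → IsShortExactSeq (G.map f) (G.map g)

/-- `α` and `β` are complementary subobjects of `Z`: their intersection is the initial object and
their union is `Z`, i.e. every subobject of `Z` containing both of them is the whole of `Z`. -/
structure IsComplement {X Y Z : A} (α : X ⟶ Z) (β : Y ⟶ Z) : Prop where
  mono_left : Mono α
  mono_right : Mono β
  inter : ∃ (O : A) (a : O ⟶ X) (b : O ⟶ Y), Nonempty (IsInitial O) ∧ IsPullback a b α β
  union : ∀ ⦃S : A⦄ (s : S ⟶ Z), Mono s → (∃ a, a ≫ s = α) → (∃ b, b ≫ s = β) → IsIso s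

/-- `α` is a complemented subobject. -/
def IsComplementedSub {X Z : A} (α : X ⟶ Z) : Prop :=
  ∃ (Y : A) (β : Y ⟶ Z), IsComplement α β

end PretorsionTheories

/-! ### Pretoposes -/

/-- A pretopos: an exact (regular, with every equivalence relation a kernel pair) and extensive
category with finite coproducts. -/
class Pretopos (C : Type u) [Category.{v} C] : Prop extends Regular C, FinitaryExtensive C where
  effective : ∀ ⦃R X : C⦄ (p₁ p₂ : R ⟶ X), IsEquivalenceRelation p₁ p₂ →
    ∃ (Q : C) (q : X ⟶ Q), IsKernelPair q p₁ p₂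

/-! ### Internal preorders -/

/-- An internal preorder in `C`: a relation `(p₁, p₂) : rel ⟶ carrier × carrier` that is reflexive
and transitive. -/
structure InternalPreorder (C : Type u) [Category.{v} C] where
  carrier : C
  rel : C
  p₁ : rel ⟶ carrier
  p₂ : rel ⟶ carrier
  isRel : JointlyMono₂ p₁ p₂
  refl : Nonempty (ReflexiveRelation p₁ p₂)
  trans : Nonempty (TransitiveRelation p₁ p₂)

namespace InternalPreorder

section Basic

variable {C : Type u} [Category.{v} C]

/-- A morphism of internal preorders. -/
@[ext]
structure Hom (X Y : InternalPreorder C) where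
  map : X.carrier ⟶ Y.carrier
  mapRel : X.rel ⟶ Y.rel
  comm₁ : mapRel ≫ Y.p₁ = X.p₁ ≫ map
  comm₂ : mapRel ≫ Y.p₂ = X.p₂ ≫ map

lemma Hom.comm₁' {X Y : InternalPreorder C} (f : Hom X Y) {T : C} (h : Y.carrier ⟶ T) :
    f.mapRel ≫ Y.p₁ ≫ h = X.p₁ ≫ f.map ≫ h := by
  rw [← Category.assoc, f.comm₁, Category.assoc]

lemma Hom.comm₂' {X Y : InternalPreorder C} (f : Hom X Y) {T : C} (h : Y.carrier ⟶ T) :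
    f.mapRel ≫ Y.p₂ ≫ h = X.p₂ ≫ f.map ≫ h := by
  rw [← Category.assoc, f.comm₂, Category.assoc]

instance : Category (InternalPreorder C) where
  Hom := Hom
  id X := ⟨𝟙 _, 𝟙 _, by simp, by simp⟩
  comp f g := ⟨f.map ≫ g.map, f.mapRel ≫ g.mapRel,
    by rw [Category.assoc, g.comm₁, f.comm₁'], by rw [Category.assoc, g.comm₂, f.comm₂']⟩
  id_comp _ := Hom.ext (Category.id_comp _) (Category.id_comp _)
  comp_id _ := Hom.ext (Category.comp_id _) (Category.comp_id _)
  assoc _ _ _ := Hom.ext (Category.assoc _ _ _) (Category.assoc _ _ _)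

@[simp] lemma id_map (X : InternalPreorder C) : Hom.map (𝟙 X) = 𝟙 X.carrier := rfl
@[simp] lemma id_mapRel (X : InternalPreorder C) : Hom.mapRel (𝟙 X) = 𝟙 X.rel := rfl
@[simp] lemma comp_map {X Y Z : InternalPreorder C} (f : X ⟶ Y) (g : Y ⟶ Z) :
    (f ≫ g).map = f.map ≫ g.map := rfl
@[simp] lemma comp_mapRel {X Y Z : InternalPreorder C} (f : X ⟶ Y) (g : Y ⟶ Z) :
    (f ≫ g).mapRel = f.mapRel ≫ g.mapRel := rfl

lemma rel_ext (X : InternalPreorder C) {T : C} {a b : T ⟶ X.rel}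
    (h₁ : a ≫ X.p₁ = b ≫ X.p₁) (h₂ : a ≫ X.p₂ = b ≫ X.p₂) : a = b :=
  X.isRel.right_cancellation a b h₁ h₂

lemma hom_ext {X Y : InternalPreorder C} {f g : X ⟶ Y} (h : f.map = g.map) : f = g := by
  have h' : f.mapRel = g.mapRel :=
    Y.rel_ext (by rw [f.comm₁, g.comm₁, h]) (by rw [f.comm₂, g.comm₂, h])
  exact Hom.ext h h'

lemma exists_trans (X : InternalPreorder C) {T : C} (a b : T ⟶ X.rel)
    (h : a ≫ X.p₂ = b ≫ X.p₁) : ∃ c : T ⟶ X.rel, c ≫ X.p₁ = a ≫ X.p₁ ∧ c ≫ X.p₂ = b ≫ X.p₂ := by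
  obtain ⟨t⟩ := X.trans
  obtain ⟨l, h₁, h₂⟩ := PullbackCone.IsLimit.lift' t.isLimit a b h
  exact ⟨l ≫ t.t, by rw [Category.assoc, t.transitivity₁, ← h₁, Category.assoc],
    by rw [Category.assoc, t.transitivity₂, ← h₂, Category.assoc]⟩

lemma mono_of_map {X Y : InternalPreorder C} (f : X ⟶ Y) (h : Mono f.map) : Mono f where
  right_cancellation _ _ e := hom_ext ((cancel_mono f.map).1 (congrArg Hom.map e))

lemma isIso_of {X Y : InternalPreorder C} (f : X ⟶ Y) (h : IsIso f.map) (h' : IsIso f.mapRel) :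
    IsIso f := by
  refine ⟨⟨Hom.mk (inv f.map) (inv f.mapRel) ?_ ?_, hom_ext ?_, hom_ext ?_⟩⟩
  · rw [IsIso.inv_comp_eq, f.comm₁', IsIso.hom_inv_id, Category.comp_id]
  · rw [IsIso.inv_comp_eq, f.comm₂', IsIso.hom_inv_id, Category.comp_id]
  · exact IsIso.hom_inv_id f.map
  · exact IsIso.inv_hom_id f.map

/-- A preorder is an equivalence relation if it is symmetric. -/
def isEquivalence (C : Type u) [Category.{v} C] : ObjectProperty (InternalPreorder C) :=
  fun X => Nonempty (SymmetricRelation X.p₁ X.p₂)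

/-- The subobject of `carrier × carrier` given by the relation of `X`. -/
noncomputable def relSubobject [HasBinaryProducts C] (X : InternalPreorder C) :
    Subobject (X.carrier ⨯ X.carrier) :=
  haveI : Mono (prod.lift X.p₁ X.p₂) := ⟨fun a b h => X.rel_ext
    (by simpa [prod.lift_fst] using congrArg (· ≫ prod.fst) h)
    (by simpa [prod.lift_snd] using congrArg (· ≫ prod.snd) h)⟩
  Subobject.mk (prod.lift X.p₁ X.p₂)

/-- The subobject of `carrier × carrier` given by the opposite relation of `X`. -/
noncomputable def opRelSubobject [HasBinaryProducts C] (X : InternalPreorder C) :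
    Subobject (X.carrier ⨯ X.carrier) :=
  haveI : Mono (prod.lift X.p₂ X.p₁) := ⟨fun a b h => X.rel_ext
    (by simpa [prod.lift_snd] using congrArg (· ≫ prod.snd) h)
    (by simpa [prod.lift_fst] using congrArg (· ≫ prod.fst) h)⟩
  Subobject.mk (prod.lift X.p₂ X.p₁)

/-- A preorder is a partial order if the intersection of its relation with the opposite relation
is the discrete relation. -/
def isPartialOrder (C : Type u) [Category.{v} C] [HasBinaryProducts C] [HasPullbacks C] :
    ObjectProperty (InternalPreorder C) :=
  fun X => X.relSubobject ⊓ X.opRelSubobject = Subobject.mk (diag X.carrier)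

/-- The trivial objects are the preorders that are both equivalence relations and partial orders. -/
def isTrivial (C : Type u) [Category.{v} C] [HasBinaryProducts C] [HasPullbacks C] :
    ObjectProperty (InternalPreorder C) :=
  isEquivalence C ⊓ isPartialOrder C

end Basic

section Construction

variable {C : Type u} [Category.{v} C] [HasPullbacks C]

/-- Constructor for preorders in terms of generalized elements. -/
noncomputable def ofElements (A R : C) (p₁ p₂ : R ⟶ A)
    (hm : ∀ ⦃T : C⦄ (a b : T ⟶ R), a ≫ p₁ = b ≫ p₁ → a ≫ p₂ = b ≫ p₂ → a = b)
    (hr : ∃ r : A ⟶ R, r ≫ p₁ = 𝟙 A ∧ r ≫ p₂ = 𝟙 A)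
    (ht : ∀ ⦃T : C⦄ (a b : T ⟶ R), a ≫ p₂ = b ≫ p₁ →
      ∃ c : T ⟶ R, c ≫ p₁ = a ≫ p₁ ∧ c ≫ p₂ = b ≫ p₂) : InternalPreorder C where
  carrier := A
  rel := R
  p₁ := p₁
  p₂ := p₂
  isRel := ⟨hm⟩
  refl := by
    obtain ⟨r, h₁, h₂⟩ := hr
    exact ⟨{ right_cancellation := hm, r := r, reflexivity₁ := h₁, reflexivity₂ := h₂ }⟩
  trans := by
    obtain ⟨c, h₁, h₂⟩ := ht (pullback.fst p₂ p₁) (pullback.snd p₂ p₁) pullback.condition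
    exact ⟨{ right_cancellation := hm
             c := PullbackCone.mk (pullback.fst p₂ p₁) (pullback.snd p₂ p₁) pullback.condition
             isLimit := pullbackIsPullback p₂ p₁
             t := c, transitivity₁ := h₁, transitivity₂ := h₂ }⟩

/-- The discrete preorder. -/
noncomputable def discrete (A : C) : InternalPreorder C :=
  ofElements A A (𝟙 A) (𝟙 A) (fun _ a b h _ => by simpa using h) ⟨𝟙 A, by simp, by simp⟩
    (fun _ a b h => ⟨a, by simp, by simpa using h⟩)

/-- Morphisms out of a discrete preorder. -/
noncomputable def discreteHom {A : C} {X : InternalPreorder C} (f : A ⟶ X.carrier) :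
    discrete A ⟶ X :=
  Hom.mk (X := discrete A) (Y := X) f (f ≫ X.refl.some.r)
    ((Category.assoc _ _ _).trans ((congrArg (f ≫ ·) X.refl.some.reflexivity₁).trans
      ((Category.comp_id f).trans (Category.id_comp f).symm)))
    ((Category.assoc _ _ _).trans ((congrArg (f ≫ ·) X.refl.some.reflexivity₂).trans
      ((Category.comp_id f).trans (Category.id_comp f).symm)))

lemma mono_map {X Y : InternalPreorder C} (f : X ⟶ Y) [Mono f] : Mono f.map where
  right_cancellation {T} a b h := by
    have : discreteHom (X := X) a ≫ f = discreteHom b ≫ f := hom_ext h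
    exact congrArg Hom.map ((cancel_mono f).1 this)

section Pullback

variable {X Y Z : InternalPreorder C} (f : X ⟶ Z) (g : Y ⟶ Z)

/-- The pullback of internal preorders, computed componentwise. -/
noncomputable def pb : InternalPreorder C :=
  ofElements (pullback f.map g.map) (pullback f.mapRel g.mapRel)
    (pullback.lift (pullback.fst _ _ ≫ X.p₁) (pullback.snd _ _ ≫ Y.p₁) (by
      rw [Category.assoc, Category.assoc, ← f.comm₁, ← g.comm₁, pullback.condition_assoc]))
    (pullback.lift (pullback.fst _ _ ≫ X.p₂) (pullback.snd _ _ ≫ Y.p₂) (by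
      rw [Category.assoc, Category.assoc, ← f.comm₂, ← g.comm₂, pullback.condition_assoc]))
    (fun T a b h₁ h₂ => by
      have e₁ := congrArg (· ≫ pullback.fst _ _) h₁
      have e₂ := congrArg (· ≫ pullback.snd _ _) h₁
      have e₃ := congrArg (· ≫ pullback.fst _ _) h₂
      have e₄ := congrArg (· ≫ pullback.snd _ _) h₂
      simp only [Category.assoc, pullback.lift_fst, pullback.lift_snd] at e₁ e₂ e₃ e₄
      exact pullback.hom_ext (X.rel_ext (by simpa using e₁) (by simpa using e₃))
        (Y.rel_ext (by simpa using e₂) (by simpa using e₄)))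
    (by
      obtain ⟨r⟩ := X.refl
      obtain ⟨s⟩ := Y.refl
      refine ⟨pullback.lift (pullback.fst _ _ ≫ r.r) (pullback.snd _ _ ≫ s.r) (Z.rel_ext ?_ ?_),
        pullback.hom_ext ?_ ?_, pullback.hom_ext ?_ ?_⟩
      · simp [f.comm₁, g.comm₁, pullback.condition]
      · simp [f.comm₂, g.comm₂, pullback.condition]
      all_goals simp [pullback.lift_fst, pullback.lift_snd, pullback.lift_fst_assoc,
        pullback.lift_snd_assoc])
    (fun T a b h => by
      have e₁ := congrArg (· ≫ pullback.fst _ _) h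
      have e₂ := congrArg (· ≫ pullback.snd _ _) h
      simp only [Category.assoc, pullback.lift_fst, pullback.lift_snd] at e₁ e₂
      obtain ⟨c, hc₁, hc₂⟩ := X.exists_trans (a ≫ pullback.fst _ _) (b ≫ pullback.fst _ _)
        (by simpa using e₁)
      obtain ⟨d, hd₁, hd₂⟩ := Y.exists_trans (a ≫ pullback.snd _ _) (b ≫ pullback.snd _ _)
        (by simpa using e₂)
      refine ⟨pullback.lift c d (Z.rel_ext ?_ ?_),
        pullback.hom_ext ?_ ?_, pullback.hom_ext ?_ ?_⟩
      · simp only [Category.assoc, f.comm₁, g.comm₁]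
        rw [reassoc_of% hc₁, reassoc_of% hd₁, ← f.comm₁, ← g.comm₁, pullback.condition_assoc]
      · simp only [Category.assoc, f.comm₂, g.comm₂]
        rw [reassoc_of% hc₂, reassoc_of% hd₂, ← f.comm₂, ← g.comm₂, pullback.condition_assoc]
      · simpa [pullback.lift_fst, pullback.lift_snd, pullback.lift_fst_assoc,
          pullback.lift_snd_assoc] using hc₁
      · simpa [pullback.lift_fst, pullback.lift_snd, pullback.lift_fst_assoc,
          pullback.lift_snd_assoc] using hd₁
      · simpa [pullback.lift_fst, pullback.lift_snd, pullback.lift_fst_assoc,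
          pullback.lift_snd_assoc] using hc₂
      · simpa [pullback.lift_fst, pullback.lift_snd, pullback.lift_fst_assoc,
          pullback.lift_snd_assoc] using hd₂)

/-- First projection of the pullback. -/
noncomputable def pbFst : pb f g ⟶ X :=
  Hom.mk (pullback.fst _ _) (pullback.fst _ _) (pullback.lift_fst _ _ _).symm
    (pullback.lift_fst _ _ _).symm

/-- Second projection of the pullback. -/
noncomputable def pbSnd : pb f g ⟶ Y :=
  Hom.mk (pullback.snd _ _) (pullback.snd _ _) (pullback.lift_snd _ _ _).symm
    (pullback.lift_snd _ _ _).symm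

lemma pb_isPullback : IsPullback (pbFst f g) (pbSnd f g) f g := by
  have w : pbFst f g ≫ f = pbSnd f g ≫ g := hom_ext pullback.condition
  refine ⟨⟨w⟩, ⟨PullbackCone.IsLimit.mk w
    (fun s => Hom.mk
      (pullback.lift s.fst.map s.snd.map (congrArg Hom.map s.condition))
      (pullback.lift s.fst.mapRel s.snd.mapRel (congrArg Hom.mapRel s.condition)) ?_ ?_)
    (fun s => hom_ext (pullback.lift_fst _ _ _)) (fun s => hom_ext (pullback.lift_snd _ _ _))
    (fun s m h₁ h₂ => hom_ext (pullback.hom_ext ?_ ?_))⟩⟩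
  · refine pullback.hom_ext ?_ ?_
    · refine (Category.assoc _ _ _).trans ((congrArg _ (pullback.lift_fst _ _ _)).trans ?_)
      exact (Category.assoc _ _ _).symm.trans ((congrArg (· ≫ X.p₁) (pullback.lift_fst _ _ _)).trans
        (s.fst.comm₁.trans ((congrArg (s.pt.p₁ ≫ ·) (pullback.lift_fst _ _ _).symm).trans
          (Category.assoc _ _ _).symm)))
    · refine (Category.assoc _ _ _).trans ((congrArg _ (pullback.lift_snd _ _ _)).trans ?_)
      exact (Category.assoc _ _ _).symm.trans ((congrArg (· ≫ Y.p₁) (pullback.lift_snd _ _ _)).trans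
        (s.snd.comm₁.trans ((congrArg (s.pt.p₁ ≫ ·) (pullback.lift_snd _ _ _).symm).trans
          (Category.assoc _ _ _).symm)))
  · refine pullback.hom_ext ?_ ?_
    · refine (Category.assoc _ _ _).trans ((congrArg _ (pullback.lift_fst _ _ _)).trans ?_)
      exact (Category.assoc _ _ _).symm.trans ((congrArg (· ≫ X.p₂) (pullback.lift_fst _ _ _)).trans
        (s.fst.comm₂.trans ((congrArg (s.pt.p₂ ≫ ·) (pullback.lift_fst _ _ _).symm).trans
          (Category.assoc _ _ _).symm)))
    · refine (Category.assoc _ _ _).trans ((congrArg _ (pullback.lift_snd _ _ _)).trans ?_)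
      exact (Category.assoc _ _ _).symm.trans ((congrArg (· ≫ Y.p₂) (pullback.lift_snd _ _ _)).trans
        (s.snd.comm₂.trans ((congrArg (s.pt.p₂ ≫ ·) (pullback.lift_snd _ _ _).symm).trans
          (Category.assoc _ _ _).symm)))
  · exact (congrArg Hom.map h₁).trans (pullback.lift_fst _ _ _).symm
  · exact (congrArg Hom.map h₂).trans (pullback.lift_snd _ _ _).symm

end Pullback

end Construction

section Extensive

variable {C : Type u} [Category.{v} C] [FinitaryExtensive C] {X Y Z X' Y' Z' : C}

lemma extensive_iff {i : X ⟶ Z} {j : Y ⟶ Z} (h : Nonempty (IsColimit (BinaryCofan.mk i j)))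
    {i' : X' ⟶ Z'} {j' : Y' ⟶ Z'} (a : X' ⟶ X) (b : Y' ⟶ Y) (f : Z' ⟶ Z)
    (ha : a ≫ i = i' ≫ f) (hb : b ≫ j = j' ≫ f) :
    Nonempty (IsColimit (BinaryCofan.mk i' j')) ↔ IsPullback i' a f i ∧ IsPullback j' b f j :=
  (BinaryCofan.isVanKampen_iff _).1 (FinitaryExtensive.van_kampen' _ h.some)
    (BinaryCofan.mk i' j') a b f ha hb

lemma coprod_ext {i : X ⟶ Z} {j : Y ⟶ Z} (h : Nonempty (IsColimit (BinaryCofan.mk i j)))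
    {T : C} {f g : Z ⟶ T} (h₁ : i ≫ f = i ≫ g) (h₂ : j ≫ f = j ≫ g) : f = g :=
  BinaryCofan.IsColimit.hom_ext h.some h₁ h₂

lemma coprod_desc {i : X ⟶ Z} {j : Y ⟶ Z} (h : Nonempty (IsColimit (BinaryCofan.mk i j)))
    {T : C} (f : X ⟶ T) (g : Y ⟶ T) : ∃ d : Z ⟶ T, i ≫ d = f ∧ j ≫ d = g :=
  let l := BinaryCofan.IsColimit.desc' h.some f g
  ⟨l.1, l.2⟩

lemma coprod_symm {i : X ⟶ Z} {j : Y ⟶ Z} (h : Nonempty (IsColimit (BinaryCofan.mk i j))) :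
    Nonempty (IsColimit (BinaryCofan.mk j i)) :=
  ⟨BinaryCofan.isColimitFlip h.some⟩

lemma coprod_mono {i : X ⟶ Z} {j : Y ⟶ Z} (h : Nonempty (IsColimit (BinaryCofan.mk i j))) :
    Mono i ∧ Mono j :=
  ⟨FinitaryExtensive.mono_inl_of_isColimit h.some, FinitaryExtensive.mono_inr_of_isColimit h.some⟩

lemma coprod_of {i : X ⟶ Z} {j : Y ⟶ Z}
    (hd : ∀ ⦃T : C⦄ (f : X ⟶ T) (g : Y ⟶ T), ∃ d : Z ⟶ T, i ≫ d = f ∧ j ≫ d = g)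
    (he : ∀ ⦃T : C⦄ (f g : Z ⟶ T), i ≫ f = i ≫ g → j ≫ f = j ≫ g → f = g) :
    Nonempty (IsColimit (BinaryCofan.mk i j)) := by
  choose d h₁ h₂ using hd
  exact ⟨BinaryCofan.isColimitMk (fun s => d s.inl s.inr) (fun s => h₁ _ _) (fun s => h₂ _ _)
    (fun s m e₁ e₂ => he _ _ (e₁.trans (h₁ _ _).symm) (e₂.trans (h₂ _ _).symm))⟩

lemma coprod_standard (X Y : C) :
    Nonempty (IsColimit (BinaryCofan.mk (coprod.inl : X ⟶ X ⨿ Y) coprod.inr)) :=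
  ⟨coprodIsCoprod X Y⟩

/-- Case distinction for generalized elements of a coproduct. -/
lemma coprod_cases [HasPullbacks C] {i : X ⟶ Z} {j : Y ⟶ Z}
    (h : Nonempty (IsColimit (BinaryCofan.mk i j))) {T : C} (f : T ⟶ Z) :
    ∃ (T₁ T₂ : C) (t₁ : T₁ ⟶ T) (t₂ : T₂ ⟶ T) (f₁ : T₁ ⟶ X) (f₂ : T₂ ⟶ Y),
      Nonempty (IsColimit (BinaryCofan.mk t₁ t₂)) ∧ f₁ ≫ i = t₁ ≫ f ∧ f₂ ≫ j = t₂ ≫ f :=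
  ⟨_, _, pullback.fst f i, pullback.fst f j, pullback.snd f i, pullback.snd f j,
    (extensive_iff h _ _ f pullback.condition.symm pullback.condition.symm).2
      ⟨IsPullback.of_hasPullback _ _, IsPullback.of_hasPullback _ _⟩,
    pullback.condition.symm, pullback.condition.symm⟩

lemma coprod_disjoint {i : X ⟶ Z} {j : Y ⟶ Z} (h : Nonempty (IsColimit (BinaryCofan.mk i j)))
    {T : C} (f : T ⟶ X) (g : T ⟶ Y) (w : f ≫ i = g ≫ j) : Nonempty (IsInitial T) := by
  have l := (FinitaryExtensive.isPullback_initial_to_binaryCofan h.some).lift f g w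
  have := initialIsInitial.isIso_to l
  exact ⟨initialIsInitial.ofIso (asIso l).symm⟩

/-- The union of two disjoint subobjects is their coproduct. -/
lemma mono_desc [HasPullbacks C] {i : X ⟶ Z} {j : Y ⟶ Z}
    (h : Nonempty (IsColimit (BinaryCofan.mk i j))) {W : C} (d : Z ⟶ W)
    (h₁ : Mono (i ≫ d)) (h₂ : Mono (j ≫ d))
    (h₀ : ∀ ⦃T : C⦄ (f : T ⟶ X) (g : T ⟶ Y), f ≫ i ≫ d = g ≫ j ≫ d → Nonempty (IsInitial T)) :
    Mono d where
  right_cancellation {T} a b e := by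
    obtain ⟨T₁, T₂, t₁, t₂, a₁, a₂, ht, ha₁, ha₂⟩ := coprod_cases h a
    refine coprod_ext ht ?_ ?_
    · obtain ⟨S₁, S₂, s₁, s₂, b₁, b₂, hs, hb₁, hb₂⟩ := coprod_cases h (t₁ ≫ b)
      refine coprod_ext hs ?_ ?_
      · rw [← hb₁, ← ha₁, ← Category.assoc]
        congr 1
        rw [← cancel_mono (i ≫ d), Category.assoc, reassoc_of% ha₁, e, reassoc_of% hb₁]
      · obtain ⟨hI⟩ := h₀ (s₂ ≫ a₁) b₂ (by
          rw [Category.assoc, reassoc_of% ha₁, e, reassoc_of% hb₂])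
        exact hI.hom_ext _ _
    · obtain ⟨S₁, S₂, s₁, s₂, b₁, b₂, hs, hb₁, hb₂⟩ := coprod_cases h (t₂ ≫ b)
      refine coprod_ext hs ?_ ?_
      · obtain ⟨hI⟩ := h₀ b₁ (s₁ ≫ a₂) (by
          rw [Category.assoc, reassoc_of% ha₂, e, reassoc_of% hb₁])
        exact hI.hom_ext _ _
      · rw [← hb₂, ← ha₂, ← Category.assoc]
        congr 1
        rw [← cancel_mono (j ≫ d), Category.assoc, reassoc_of% ha₂, e, reassoc_of% hb₂]

end Extensive

section Coproduct

variable {C : Type u} [Category.{v} C] [HasPullbacks C] [FinitaryExtensive C]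

/-- The coproduct of internal preorders, computed componentwise. -/
noncomputable def sum (X Y : InternalPreorder C) : InternalPreorder C :=
  ofElements (X.carrier ⨿ Y.carrier) (X.rel ⨿ Y.rel) (coprod.map X.p₁ Y.p₁) (coprod.map X.p₂ Y.p₂)
    (fun T a b h₁ h₂ => by
      have hs := coprod_standard X.carrier Y.carrier
      have pb₁ := (extensive_iff hs X.p₁ Y.p₁ (coprod.map X.p₁ Y.p₁) (coprod.inl_map _ _).symm
        (coprod.inr_map _ _).symm).1 (coprod_standard X.rel Y.rel)
      obtain ⟨T₁, T₂, t₁, t₂, a₁, a₂, ht, ha₁, ha₂⟩ :=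
        coprod_cases (coprod_standard X.rel Y.rel) a
      have hm := coprod_mono hs
      have := hm.1
      have := hm.2
      refine coprod_ext ht ?_ ?_
      · obtain ⟨b₁, hb₁, -⟩ := pb₁.1.exists_lift (t₁ ≫ b) (a₁ ≫ X.p₁) (by
          rw [Category.assoc, ← h₁, ← reassoc_of% ha₁, coprod.inl_map, Category.assoc])
        rw [← ha₁, ← hb₁]
        congr 1
        refine X.rel_ext ?_ ?_
        · rw [← cancel_mono (coprod.inl : X.carrier ⟶ X.carrier ⨿ Y.carrier), Category.assoc,
            Category.assoc, ← coprod.inl_map X.p₁ Y.p₁, reassoc_of% ha₁, reassoc_of% hb₁, h₁]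
        · rw [← cancel_mono (coprod.inl : X.carrier ⟶ X.carrier ⨿ Y.carrier), Category.assoc,
            Category.assoc, ← coprod.inl_map X.p₂ Y.p₂, reassoc_of% ha₁, reassoc_of% hb₁, h₂]
      · obtain ⟨b₂, hb₂, -⟩ := pb₁.2.exists_lift (t₂ ≫ b) (a₂ ≫ Y.p₁) (by
          rw [Category.assoc, ← h₁, ← reassoc_of% ha₂, coprod.inr_map, Category.assoc])
        rw [← ha₂, ← hb₂]
        congr 1
        refine Y.rel_ext ?_ ?_
        · rw [← cancel_mono (coprod.inr : Y.carrier ⟶ X.carrier ⨿ Y.carrier), Category.assoc,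
            Category.assoc, ← coprod.inr_map X.p₁ Y.p₁, reassoc_of% ha₂, reassoc_of% hb₂, h₁]
        · rw [← cancel_mono (coprod.inr : Y.carrier ⟶ X.carrier ⨿ Y.carrier), Category.assoc,
            Category.assoc, ← coprod.inr_map X.p₂ Y.p₂, reassoc_of% ha₂, reassoc_of% hb₂, h₂])
    (by
      obtain ⟨r⟩ := X.refl
      obtain ⟨s⟩ := Y.refl
      refine ⟨coprod.map r.r s.r, ?_, ?_⟩ <;>
        rw [coprod.map_map] <;> simp)
    (fun T a b h => by
      have hs := coprod_standard X.carrier Y.carrier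
      have pb₁ := (extensive_iff hs X.p₁ Y.p₁ (coprod.map X.p₁ Y.p₁) (coprod.inl_map _ _).symm
        (coprod.inr_map _ _).symm).1 (coprod_standard X.rel Y.rel)
      obtain ⟨T₁, T₂, t₁, t₂, a₁, a₂, ht, ha₁, ha₂⟩ :=
        coprod_cases (coprod_standard X.rel Y.rel) a
      obtain ⟨b₁, hb₁, hb₁'⟩ := pb₁.1.exists_lift (t₁ ≫ b) (a₁ ≫ X.p₂) (by
        rw [Category.assoc, ← h, ← reassoc_of% ha₁, coprod.inl_map, Category.assoc])
      obtain ⟨b₂, hb₂, hb₂'⟩ := pb₁.2.exists_lift (t₂ ≫ b) (a₂ ≫ Y.p₂) (by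
        rw [Category.assoc, ← h, ← reassoc_of% ha₂, coprod.inr_map, Category.assoc])
      obtain ⟨c₁, hc₁, hc₁'⟩ := X.exists_trans a₁ b₁ hb₁'.symm
      obtain ⟨c₂, hc₂, hc₂'⟩ := Y.exists_trans a₂ b₂ hb₂'.symm
      obtain ⟨c, e₁, e₂⟩ := coprod_desc ht (c₁ ≫ coprod.inl) (c₂ ≫ coprod.inr)
      refine ⟨c, coprod_ext ht ?_ ?_, coprod_ext ht ?_ ?_⟩
      · rw [reassoc_of% e₁, coprod.inl_map, reassoc_of% hc₁, ← reassoc_of% ha₁, coprod.inl_map]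
      · rw [reassoc_of% e₂, coprod.inr_map, reassoc_of% hc₂, ← reassoc_of% ha₂, coprod.inr_map]
      · rw [reassoc_of% e₁, coprod.inl_map, reassoc_of% hc₁', ← reassoc_of% hb₁, coprod.inl_map]
      · rw [reassoc_of% e₂, coprod.inr_map, reassoc_of% hc₂', ← reassoc_of% hb₂, coprod.inr_map])

/-- `Z` is the componentwise coproduct of `X` and `Y`. -/
def IsDecomp {X Y Z : InternalPreorder C} (α : X ⟶ Z) (β : Y ⟶ Z) : Prop :=
  Nonempty (IsColimit (BinaryCofan.mk α.map β.map)) ∧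
    Nonempty (IsColimit (BinaryCofan.mk α.mapRel β.mapRel))

lemma isInitial_carrier {O : InternalPreorder C} (h : IsInitial O) :
    Nonempty (IsInitial O.carrier) := by
  have l : O ⟶ discrete (⊥_ C) := h.to _
  let l' : O.carrier ⟶ ⊥_ C := l.map
  have := initialIsInitial.isIso_to l'
  exact ⟨initialIsInitial.ofIso (asIso l').symm⟩

lemma isInitial_of_carrier {O : InternalPreorder C} (h : IsInitial O.carrier) :
    Nonempty (IsInitial O) := by
  have := h.isIso_to O.p₁
  have h' : IsInitial O.rel := h.ofIso (asIso O.p₁).symm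
  exact ⟨IsInitial.ofUniqueHom (fun Y => Hom.mk (h.to _) (h'.to _) (h'.hom_ext _ _) (h'.hom_ext _ _))
    (fun Y m => hom_ext (h.hom_ext _ _))⟩

lemma IsDecomp.isComplement {X Y Z : InternalPreorder C} {α : X ⟶ Z} {β : Y ⟶ Z}
    (h : IsDecomp α β) : IsComplement α β where
  mono_left := mono_of_map _ (coprod_mono h.1).1
  mono_right := mono_of_map _ (coprod_mono h.1).2
  inter := by
    refine ⟨pb α β, _, _, ?_, pb_isPullback α β⟩
    obtain ⟨hI⟩ := coprod_disjoint h.1 _ _ (congrArg Hom.map (pb_isPullback α β).w)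
    exact isInitial_of_carrier hI
  union S s hs := by
    rintro ⟨a, ha⟩ ⟨b, hb⟩
    have hm := mono_map s
    have hm' : Mono s.mapRel := ⟨fun f g e => S.rel_ext
      (by rw [← cancel_mono s.map, Category.assoc, Category.assoc, ← s.comm₁, reassoc_of% e])
      (by rw [← cancel_mono s.map, Category.assoc, Category.assoc, ← s.comm₂, reassoc_of% e])⟩
    have iso_of : ∀ {P Q : C} (f : P ⟶ Q) (g : Q ⟶ P), Mono f → g ≫ f = 𝟙 Q → IsIso f :=
      fun f g _ e => ⟨g, by rw [← cancel_mono f, Category.assoc, e]; simp, e⟩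
    refine isIso_of s ?_ ?_
    · obtain ⟨d, h₁, h₂⟩ := coprod_desc h.1 a.map b.map
      refine iso_of _ d hm (coprod_ext h.1 ?_ ?_)
      · rw [reassoc_of% h₁, Category.comp_id]; exact congrArg Hom.map ha
      · rw [reassoc_of% h₂, Category.comp_id]; exact congrArg Hom.map hb
    · obtain ⟨d, h₁, h₂⟩ := coprod_desc h.2 a.mapRel b.mapRel
      refine iso_of _ d hm' (coprod_ext h.2 ?_ ?_)
      · rw [reassoc_of% h₁, Category.comp_id]; exact congrArg Hom.mapRel ha
      · rw [reassoc_of% h₂, Category.comp_id]; exact congrArg Hom.mapRel hb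

lemma coprod_of_iso {X Y Z Z' : C} {i : X ⟶ Z} {j : Y ⟶ Z}
    (h : Nonempty (IsColimit (BinaryCofan.mk i j))) (d : Z ⟶ Z') (hd : IsIso d) {i' : X ⟶ Z'}
    {j' : Y ⟶ Z'} (hi : i ≫ d = i') (hj : j ≫ d = j') :
    Nonempty (IsColimit (BinaryCofan.mk i' j')) := by
  subst hi hj
  refine coprod_of (fun T f g => ?_) (fun T f g h₁ h₂ => ?_)
  · obtain ⟨e, h₁, h₂⟩ := coprod_desc h f g
    exact ⟨inv d ≫ e, by simpa using h₁, by simpa using h₂⟩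
  · rw [← cancel_epi d]
    exact coprod_ext h (by simpa using h₁) (by simpa using h₂)

/-- Complementary subobjects are the same as componentwise coproduct decompositions. -/
lemma isComplement_iff {X Y Z : InternalPreorder C} {α : X ⟶ Z} {β : Y ⟶ Z} :
    IsComplement α β ↔ IsDecomp α β := by
  refine ⟨fun h => ?_, IsDecomp.isComplement⟩
  let i : X ⟶ sum X Y := Hom.mk (Y := sum X Y) coprod.inl coprod.inl (coprod.inl_map _ _)
    (coprod.inl_map _ _)
  let j : Y ⟶ sum X Y := Hom.mk (Y := sum X Y) coprod.inr coprod.inr (coprod.inr_map _ _)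
    (coprod.inr_map _ _)
  have hij : IsDecomp i j := ⟨coprod_standard _ _, coprod_standard _ _⟩
  obtain ⟨d, d₁, d₂⟩ := coprod_desc hij.1 α.map β.map
  obtain ⟨e, e₁, e₂⟩ := coprod_desc hij.2 α.mapRel β.mapRel
  let s : sum X Y ⟶ Z := Hom.mk d e
    (coprod_ext hij.2
      (by rw [reassoc_of% e₁, ← Category.assoc, i.comm₁, Category.assoc, d₁, α.comm₁])
      (by rw [reassoc_of% e₂, ← Category.assoc, j.comm₁, Category.assoc, d₂, β.comm₁]))
    (coprod_ext hij.2
      (by rw [reassoc_of% e₁, ← Category.assoc, i.comm₂, Category.assoc, d₁, α.comm₂])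
      (by rw [reassoc_of% e₂, ← Category.assoc, j.comm₂, Category.assoc, d₂, β.comm₂]))
  have hα := h.mono_left
  have hβ := h.mono_right
  have hmα := mono_map α
  have hmβ := mono_map β
  have hs : Mono s := by
    refine mono_of_map s (mono_desc hij.1 d (by rw [d₁]; exact hmα) (by rw [d₂]; exact hmβ) ?_)
    intro T f g w
    rw [d₁, d₂] at w
    obtain ⟨O, a, b, ⟨hO⟩, hp⟩ := h.inter
    obtain ⟨l, -, -⟩ := hp.exists_lift (discreteHom f) (discreteHom g) (hom_ext w)
    obtain ⟨hI⟩ := isInitial_carrier hO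
    have := hI.isIso_to (l.map : T ⟶ O.carrier)
    exact ⟨hI.ofIso (asIso (l.map : T ⟶ O.carrier)).symm⟩
  have := h.union s hs ⟨i, hom_ext d₁⟩ ⟨j, hom_ext d₂⟩
  have iso₁ : IsIso s.map := ⟨(inv s).map, congrArg Hom.map (IsIso.hom_inv_id s),
    congrArg Hom.map (IsIso.inv_hom_id s)⟩
  have iso₂ : IsIso s.mapRel := ⟨(inv s).mapRel, congrArg Hom.mapRel (IsIso.hom_inv_id s),
    congrArg Hom.mapRel (IsIso.inv_hom_id s)⟩
  exact ⟨coprod_of_iso hij.1 s.map iso₁ d₁ d₂, coprod_of_iso hij.2 s.mapRel iso₂ e₁ e₂⟩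

lemma isComplementedSub_id (X : InternalPreorder C) : IsComplementedSub (𝟙 X) := by
  refine ⟨_, discreteHom (initial.to X.carrier), IsDecomp.isComplement ⟨?_, ?_⟩⟩
  · exact coprod_of (fun T f g => ⟨f, Category.id_comp f, initialIsInitial.hom_ext _ _⟩)
      (fun T f g h _ => by simpa using h)
  · exact coprod_of (fun T f g => ⟨f, Category.id_comp f, initialIsInitial.hom_ext _ _⟩)
      (fun T f g h _ => by simpa using h)

lemma coprod_assoc {X X' Y Y' Z P : C} {i : X ⟶ Y} {i' : X' ⟶ Y} {j : Y ⟶ Z} {j' : Y' ⟶ Z}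
    {k : X' ⟶ P} {k' : Y' ⟶ P} (hi : Nonempty (IsColimit (BinaryCofan.mk i i')))
    (hj : Nonempty (IsColimit (BinaryCofan.mk j j')))
    (hk : Nonempty (IsColimit (BinaryCofan.mk k k'))) {d : P ⟶ Z} (h : k ≫ d = i' ≫ j)
    (h' : k' ≫ d = j') : Nonempty (IsColimit (BinaryCofan.mk (i ≫ j) d)) := by
  refine coprod_of (fun T f g => ?_) (fun T f g h₁ h₂ => ?_)
  · obtain ⟨a, a₁, a₂⟩ := coprod_desc hi f (k ≫ g)
    obtain ⟨b, b₁, b₂⟩ := coprod_desc hj a (k' ≫ g)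
    refine ⟨b, by rw [Category.assoc, b₁, a₁], coprod_ext hk ?_ ?_⟩
    · rw [reassoc_of% h, b₁, a₂]
    · rw [reassoc_of% h', b₂]
  · refine coprod_ext hj (coprod_ext hi ?_ ?_) ?_
    · simpa using h₁
    · rw [← reassoc_of% h, ← reassoc_of% h, h₂]
    · rw [← h', Category.assoc, Category.assoc, h₂]

lemma isComplementedSub_comp {X Y Z : InternalPreorder C} {α : X ⟶ Y} {β : Y ⟶ Z}
    (hα : IsComplementedSub α) (hβ : IsComplementedSub β) : IsComplementedSub (α ≫ β) := by
  obtain ⟨X', α', hα⟩ := hα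
  obtain ⟨Y', β', hβ⟩ := hβ
  rw [isComplement_iff] at hα hβ
  let d : sum X' Y' ⟶ Z := Hom.mk (X := sum X' Y') (Y := Z)
    (coprod.desc (α' ≫ β).map β'.map) (coprod.desc (α' ≫ β).mapRel β'.mapRel)
    (coprod_ext (coprod_standard X'.rel Y'.rel)
      (by erw [coprod.inl_desc_assoc, coprod.inl_map_assoc, coprod.inl_desc]
          exact (α' ≫ β).comm₁)
      (by erw [coprod.inr_desc_assoc, coprod.inr_map_assoc, coprod.inr_desc]
          exact β'.comm₁))
    (coprod_ext (coprod_standard X'.rel Y'.rel)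
      (by erw [coprod.inl_desc_assoc, coprod.inl_map_assoc, coprod.inl_desc]
          exact (α' ≫ β).comm₂)
      (by erw [coprod.inr_desc_assoc, coprod.inr_map_assoc, coprod.inr_desc]
          exact β'.comm₂))
  refine ⟨_, d, IsDecomp.isComplement ⟨?_, ?_⟩⟩
  · exact coprod_assoc hα.1 hβ.1 (coprod_standard X'.carrier Y'.carrier) (coprod.inl_desc _ _)
      (coprod.inr_desc _ _)
  · exact coprod_assoc hα.2 hβ.2 (coprod_standard X'.rel Y'.rel) (coprod.inl_desc _ _)
      (coprod.inr_desc _ _)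

lemma isComplementedSub_pbFst {X Y Z : InternalPreorder C} (f : X ⟶ Z) {α : Y ⟶ Z}
    (hα : IsComplementedSub α) : IsComplementedSub (pbFst f α) := by
  obtain ⟨Y', β, h⟩ := hα
  rw [isComplement_iff] at h
  refine ⟨_, pbFst f β, IsDecomp.isComplement ⟨?_, ?_⟩⟩
  · exact (extensive_iff h.1 _ _ f.map pullback.condition.symm pullback.condition.symm).2
      ⟨IsPullback.of_hasPullback _ _, IsPullback.of_hasPullback _ _⟩
  · exact (extensive_iff h.2 _ _ f.mapRel pullback.condition.symm pullback.condition.symm).2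
      ⟨IsPullback.of_hasPullback _ _, IsPullback.of_hasPullback _ _⟩

end Coproduct

end InternalPreorder

/-! ### Partial morphisms of preorders -/

section Partial

variable {C : Type u} [Category.{v} C]

open InternalPreorder

/-- A representative of a partial morphism `X ⇀ Y`: a complemented subobject `ι : dom ⟶ X` together
with a morphism `map : dom ⟶ Y`. -/
structure PartialMap (X Y : InternalPreorder C) where
  dom : InternalPreorder C
  ι : dom ⟶ X
  map : dom ⟶ Y
  complemented : IsComplementedSub ι

namespace PartialMap

/-- Two representatives agree if they are isomorphic: subobjects are only determined up to
isomorphism. -/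
def Rel {X Y : InternalPreorder C} (s t : PartialMap X Y) : Prop :=
  ∃ e : s.dom ≅ t.dom, e.hom ≫ t.ι = s.ι ∧ e.hom ≫ t.map = s.map

instance setoid (X Y : InternalPreorder C) : Setoid (PartialMap X Y) where
  r := Rel
  iseqv :=
    { refl := fun s => ⟨Iso.refl _, Category.id_comp _, Category.id_comp _⟩
      symm := fun ⟨e, h₁, h₂⟩ => ⟨e.symm, by rw [← h₁]; simp, by rw [← h₂]; simp⟩
      trans := fun ⟨e, h₁, h₂⟩ ⟨e', h₁', h₂'⟩ => ⟨e ≪≫ e', by simp [h₁', h₁], by simp [h₂', h₂]⟩ }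

lemma mono_ι {X Y : InternalPreorder C} (s : PartialMap X Y) : Mono s.ι := by
  obtain ⟨_, _, h⟩ := s.complemented
  exact h.mono_left

lemma rel_of {X Y : InternalPreorder C} {s t : PartialMap X Y} (a : s.dom ⟶ t.dom)
    (b : t.dom ⟶ s.dom) (ha : a ≫ t.ι = s.ι) (hb : b ≫ s.ι = t.ι) (h : a ≫ t.map = s.map) :
    s ≈ t := by
  have := s.mono_ι
  have := t.mono_ι
  exact ⟨⟨a, b, by rw [← cancel_mono s.ι]; simp [ha, hb], by rw [← cancel_mono t.ι]; simp [ha, hb]⟩,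
    ha, h⟩

variable [HasPullbacks C] [FinitaryExtensive C]

/-- A total morphism as a partial morphism. -/
def ofHom {X Y : InternalPreorder C} (f : X ⟶ Y) : PartialMap X Y where
  dom := X
  ι := 𝟙 X
  map := f
  complemented := isComplementedSub_id X

/-- Composition of representatives, by pulling back the domain of the second one along the first
one. -/
@[reducible]
noncomputable def comp {X Y Z : InternalPreorder C} (s : PartialMap X Y) (t : PartialMap Y Z) :
    PartialMap X Z where
  dom := pb s.map t.ι
  ι := pbFst s.map t.ι ≫ s.ι
  map := pbSnd s.map t.ι ≫ t.map
  complemented := isComplementedSub_comp (isComplementedSub_pbFst _ t.complemented) s.complemented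

lemma comp_congr {X Y Z : InternalPreorder C} {s s' : PartialMap X Y} {t t' : PartialMap Y Z}
    (h : s ≈ s') (h' : t ≈ t') : comp s t ≈ comp s' t' := by
  obtain ⟨e, h₁, h₂⟩ := h
  obtain ⟨e', h₁', h₂'⟩ := h'
  have hp := pb_isPullback s.map t.ι
  have hp' := pb_isPullback s'.map t'.ι
  have k₁ : e.inv ≫ s.map = s'.map := by rw [← h₂]; simp
  have k₂ : e.inv ≫ s.ι = s'.ι := by rw [← h₁]; simp
  have k₁' : e'.inv ≫ t.ι = t'.ι := by rw [← h₁']; simp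
  obtain ⟨a, a₁, a₂⟩ := hp'.exists_lift (pbFst s.map t.ι ≫ e.hom) (pbSnd s.map t.ι ≫ e'.hom)
    (by rw [Category.assoc, Category.assoc, h₂, h₁', hp.w])
  obtain ⟨b, b₁, b₂⟩ := hp.exists_lift (pbFst s'.map t'.ι ≫ e.inv) (pbSnd s'.map t'.ι ≫ e'.inv)
    (by rw [Category.assoc, Category.assoc, k₁, k₁', hp'.w])
  refine rel_of (s := comp s t) (t := comp s' t') a b ?_ ?_ ?_
  · change a ≫ pbFst _ _ ≫ _ = pbFst _ _ ≫ _
    rw [reassoc_of% a₁, h₁]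
  · change b ≫ pbFst _ _ ≫ _ = pbFst _ _ ≫ _
    rw [reassoc_of% b₁, k₂]
  · change a ≫ pbSnd _ _ ≫ _ = pbSnd _ _ ≫ _
    rw [reassoc_of% a₂, h₂']

lemma id_comp {X Y : InternalPreorder C} (s : PartialMap X Y) : comp (ofHom (𝟙 X)) s ≈ s := by
  have hp := pb_isPullback (𝟙 X) s.ι
  obtain ⟨b, b₁, b₂⟩ := hp.exists_lift s.ι (𝟙 s.dom) (by simp)
  refine rel_of (s := comp (ofHom (𝟙 X)) s) (t := s) (pbSnd (𝟙 X) s.ι) b ?_ ?_ rfl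
  · exact hp.w.symm
  · change b ≫ pbFst (𝟙 X) s.ι ≫ 𝟙 X = s.ι
    rw [reassoc_of% b₁, Category.comp_id]

lemma comp_id {X Y : InternalPreorder C} (s : PartialMap X Y) : comp s (ofHom (𝟙 Y)) ≈ s := by
  have hp := pb_isPullback s.map (𝟙 Y)
  obtain ⟨b, b₁, b₂⟩ := hp.exists_lift (𝟙 s.dom) s.map (by simp)
  refine rel_of (s := comp s (ofHom (𝟙 Y))) (t := s) (pbFst s.map (𝟙 Y)) b rfl ?_ hp.w
  change b ≫ pbFst s.map (𝟙 Y) ≫ s.ι = s.ι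
  rw [reassoc_of% b₁]

lemma comp_assoc_aux {A : Type u₁} [Category.{v₁} A] {S T R X Y Z P L M N : A}
    {f : S ⟶ Y} {i : T ⟶ Y} {g : T ⟶ Z} {j : R ⟶ Z}
    {p : P ⟶ S} {p' : P ⟶ T} {m : M ⟶ T} {m' : M ⟶ R} {l : L ⟶ P} {l' : L ⟶ R}
    {n : N ⟶ S} {n' : N ⟶ M} (hP : IsPullback p p' f i) (hM : IsPullback m m' g j)
    (hL : IsPullback l l' (p' ≫ g) j) (hN : IsPullback n n' f (m ≫ i)) :
    ∃ (a : L ⟶ N) (b : N ⟶ L), a ≫ n = l ≫ p ∧ a ≫ n' ≫ m' = l' ∧ b ≫ l ≫ p = n := by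
  obtain ⟨c, c₁, c₂⟩ := hM.exists_lift (l ≫ p') l' (by rw [Category.assoc, hL.w])
  obtain ⟨a, a₁, a₂⟩ := hN.exists_lift (l ≫ p) c
    (by rw [reassoc_of% c₁, Category.assoc, hP.w])
  obtain ⟨q, q₁, q₂⟩ := hP.exists_lift n (n' ≫ m) (by rw [Category.assoc, hN.w])
  obtain ⟨b, b₁, b₂⟩ := hL.exists_lift q (n' ≫ m')
    (by rw [reassoc_of% q₂, Category.assoc, hM.w])
  exact ⟨a, b, a₁, by rw [reassoc_of% a₂, c₂], by rw [reassoc_of% b₁, q₁]⟩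

lemma comp_assoc {X Y Z W : InternalPreorder C} (s : PartialMap X Y) (t : PartialMap Y Z)
    (r : PartialMap Z W) : comp (comp s t) r ≈ comp s (comp t r) := by
  obtain ⟨a, b, h₁, h₂, h₃⟩ := comp_assoc_aux (X := X) (pb_isPullback s.map t.ι)
    (pb_isPullback t.map r.ι) (pb_isPullback (comp s t).map r.ι)
    (pb_isPullback s.map (comp t r).ι)
  refine rel_of (s := comp (comp s t) r) (t := comp s (comp t r)) a b ?_ ?_ ?_
  · exact (Category.assoc _ _ _).symm.trans ((congrArg (· ≫ s.ι) h₁).trans (Category.assoc _ _ _))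
  · refine Eq.trans ?_ (congrArg (· ≫ s.ι) h₃)
    exact (congrArg (b ≫ ·) (Category.assoc _ _ _).symm).trans (Category.assoc _ _ _).symm
  · refine Eq.trans ?_ (congrArg (· ≫ r.map) h₂)
    exact (congrArg (a ≫ ·) (Category.assoc _ _ _).symm).trans (Category.assoc _ _ _).symm

lemma ofHom_comp {X Y Z : InternalPreorder C} (f : X ⟶ Y) (g : Y ⟶ Z) :
    ofHom (f ≫ g) ≈ comp (ofHom f) (ofHom g) := by
  have hp := pb_isPullback f (𝟙 Y)
  obtain ⟨a, a₁, a₂⟩ := hp.exists_lift (𝟙 X) f (by simp)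
  refine rel_of (s := ofHom (f ≫ g)) (t := comp (ofHom f) (ofHom g)) a (pbFst f (𝟙 Y)) ?_ rfl ?_
  · change a ≫ pbFst f (𝟙 Y) ≫ 𝟙 X = 𝟙 X
    rw [reassoc_of% a₁]
  · change a ≫ pbSnd f (𝟙 Y) ≫ g = f ≫ g
    rw [reassoc_of% a₂]

end PartialMap

variable (C) in
/-- The category of internal preorders and partial morphisms. -/
structure PaPreOrd where
  as : InternalPreorder C

noncomputable instance [HasPullbacks C] [FinitaryExtensive C] :
    Category.{max u v} (PaPreOrd C) where
  Hom X Y := _root_.Quotient (PartialMap.setoid X.as Y.as)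
  id X := ⟦PartialMap.ofHom (𝟙 X.as)⟧
  comp f g := Quotient.map₂ PartialMap.comp
    (fun _ _ h _ _ h' => PartialMap.comp_congr h h') f g
  id_comp f := _root_.Quotient.inductionOn f fun s => _root_.Quotient.sound s.id_comp
  comp_id f := _root_.Quotient.inductionOn f fun s => _root_.Quotient.sound s.comp_id
  assoc f g h := Quotient.inductionOn₃ f g h fun s t r =>
    _root_.Quotient.sound (PartialMap.comp_assoc s t r)

/-- The partial morphism with a given representative. -/
def PartialMap.toHom [HasPullbacks C] [FinitaryExtensive C] {X Y : InternalPreorder C}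
    (s : PartialMap X Y) : (PaPreOrd.mk X) ⟶ (PaPreOrd.mk Y) :=
  Quotient.mk (PartialMap.setoid X Y) s

variable (C) in
/-- The inclusion functor from preorders with total morphisms to preorders with partial
morphisms. -/
noncomputable def paInclusion [HasPullbacks C] [FinitaryExtensive C] : InternalPreorder C ⥤ PaPreOrd C where
  obj X := ⟨X⟩
  map f := (PartialMap.ofHom f).toHom
  map_id _ := rfl
  map_comp f g := _root_.Quotient.sound (PartialMap.ofHom_comp f g)

/-! ### The stable category -/

/-- The existence of a congruence diagram between two representatives `s`, `t` of partial morphisms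
`X ⇀ Y`: a common complemented subobject `i`, `j` of their domains on which they coincide and such
that both are trivial on its complements `i'`, `j'`. -/
def CongruenceDiagram [HasBinaryProducts C] [HasPullbacks C] {X Y : InternalPreorder C}
    (s t : PartialMap X Y) : Prop :=
  ∃ (A₀ A₁ A₂ : InternalPreorder C) (i : A₀ ⟶ s.dom) (i' : A₁ ⟶ s.dom)
    (j : A₀ ⟶ t.dom) (j' : A₂ ⟶ t.dom),
    IsComplement i i' ∧ IsComplement j j' ∧
    i ≫ s.ι = j ≫ t.ι ∧ IsComplementedSub (i ≫ s.ι) ∧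
    i ≫ s.map = j ≫ t.map ∧
    IsTrivialMor (isTrivial C) (i' ≫ s.map) ∧ IsTrivialMor (isTrivial C) (j' ≫ t.map)

variable (C) in
/-- The relation on partial morphisms of being connected by a congruence diagram. -/
def stableRel [HasBinaryProducts C] [HasPullbacks C] [FinitaryExtensive C] : HomRel (PaPreOrd C) :=
  fun X Y f g => ∃ s t : PartialMap X.as Y.as, s.toHom = f ∧ t.toHom = g ∧ CongruenceDiagram s t

variable (C) in
/-- The stable category: the quotient of the category of partial morphisms by the congruence
`stableRel`. -/
abbrev Stab [HasBinaryProducts C] [HasPullbacks C] [FinitaryExtensive C] :=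
  CategoryTheory.Quotient (stableRel C)

variable (C) in
/-- The canonical functor from preorders to the stable category. -/
noncomputable def stabFunctor [HasBinaryProducts C] [HasPullbacks C] [FinitaryExtensive C] :
    InternalPreorder C ⥤ Stab C :=
  paInclusion C ⋙ CategoryTheory.Quotient.functor (stableRel C)

/-- The class of objects of the stable category given by a class of preorders. -/
def stabProperty [HasBinaryProducts C] [HasPullbacks C] [FinitaryExtensive C]
    (P : ObjectProperty (InternalPreorder C)) : ObjectProperty (Stab C) :=
  fun X => P X.as.as

lemma PartialMap.rel_of_initial [HasPullbacks C] [FinitaryExtensive C] {X Y : InternalPreorder C}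
    (s t : PartialMap X Y) (hs : Nonempty (IsInitial s.dom)) (ht : Nonempty (IsInitial t.dom)) :
    s ≈ t :=
  PartialMap.rel_of (hs.some.to _) (ht.some.to _) (hs.some.hom_ext _ _) (ht.some.hom_ext _ _)
    (hs.some.hom_ext _ _)

lemma isInitial_of_hom [HasPullbacks C] [FinitaryExtensive C] {X : InternalPreorder C}
    (f : X ⟶ discrete (⊥_ C)) : Nonempty (IsInitial X) := by
  let l : X.carrier ⟶ ⊥_ C := f.map
  have := initialIsInitial.isIso_to l
  exact isInitial_of_carrier (initialIsInitial.ofIso (asIso l).symm)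

lemma isComplementedSub_initial [HasPullbacks C] [FinitaryExtensive C] (X : InternalPreorder C) :
    IsComplementedSub (discreteHom (X := X) (initial.to X.carrier)) := by
  refine ⟨X, 𝟙 X, IsDecomp.isComplement ⟨?_, ?_⟩⟩
  · exact coprod_of (fun T f g => ⟨g, initialIsInitial.hom_ext _ _, Category.id_comp g⟩)
      (fun T f g _ h => by simpa using h)
  · exact coprod_of (fun T f g => ⟨g, initialIsInitial.hom_ext _ _, Category.id_comp g⟩)
      (fun T f g _ h => by simpa using h)

/-- The stable category is pointed, with zero object the initial preorder. -/
lemma isZero_stab [HasBinaryProducts C] [HasPullbacks C] [FinitaryExtensive C] :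
    IsZero ((stabFunctor C).obj (discrete (⊥_ C))) := by
  let Z : InternalPreorder C := discrete (⊥_ C)
  let Q := CategoryTheory.Quotient.functor (stableRel C)
  have hinit : ∀ X : InternalPreorder C, (X ⟶ Z) → Nonempty (IsInitial X) :=
    fun X f => isInitial_of_hom f
  have hl : ∀ (Y : PaPreOrd C) (f g : PaPreOrd.mk Z ⟶ Y), f = g := by
    intro Y f g
    obtain ⟨s, rfl⟩ := Quotient.exists_rep f
    obtain ⟨t, rfl⟩ := Quotient.exists_rep g
    exact _root_.Quotient.sound (PartialMap.rel_of_initial _ _ (hinit _ s.ι) (hinit _ t.ι))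
  have hr : ∀ (Y : PaPreOrd C) (f g : Y ⟶ PaPreOrd.mk Z), f = g := by
    intro Y f g
    obtain ⟨s, rfl⟩ := Quotient.exists_rep f
    obtain ⟨t, rfl⟩ := Quotient.exists_rep g
    exact _root_.Quotient.sound (PartialMap.rel_of_initial _ _ (hinit _ s.map) (hinit _ t.map))
  have hQ : IsZero (Q.obj (PaPreOrd.mk Z)) := by
    refine ⟨fun Y => ⟨⟨⟨Q.map (X := PaPreOrd.mk Z) (Y := Y.as)
        (PartialMap.toHom (PartialMap.ofHom (discreteHom (initial.to Y.as.as.carrier))))⟩, ?_⟩⟩,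
      fun Y => ⟨⟨⟨Q.map (X := Y.as) (Y := PaPreOrd.mk Z) (PartialMap.toHom
        ⟨Z, discreteHom (initial.to _), 𝟙 Z, isComplementedSub_initial _⟩)⟩, ?_⟩⟩⟩
    · intro f
      obtain ⟨f, rfl⟩ := Q.map_surjective (X := PaPreOrd.mk Z) (Y := Y.as) f
      exact congrArg Q.map (hl _ _ _)
    · intro f
      obtain ⟨f, rfl⟩ := Q.map_surjective (X := Y.as) (Y := PaPreOrd.mk Z) f
      exact congrArg Q.map (hr _ _ _)
  exact hQ

instance [HasBinaryProducts C] [HasPullbacks C] [FinitaryExtensive C] : HasZeroObject (Stab C) :=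
  ⟨⟨_, isZero_stab⟩⟩

/-- The zero morphisms of the stable category: those factoring through the zero object. -/
noncomputable instance [HasBinaryProducts C] [HasPullbacks C] [FinitaryExtensive C] :
    HasZeroMorphisms (Stab C) :=
  HasZeroObject.zeroMorphismsOfZeroObject

end Partial

/-!
Everything rests on two reformulations.

*Trivial morphisms.* A morphism of internal preorders is trivial exactly when it coequalizes the two
legs of the relation of its domain (`InternalPreorder.isTrivialMor_iff`): it then factors through
the discrete preorder on the carrier of its codomain. Hence triviality can be tested on the summands
of a coproduct decomposition and is reflected by monomorphisms of carriers, and every morphism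
to or from a discrete preorder is trivial. The canonical sequence of a preorder `R` on `A` is the
inclusion of the equivalence relation `R ∩ R°` on `A`, followed by the quotient of `A` by it, ordered
by the image of `R`. Barr-exactness provides the quotient as a regular epimorphism whose kernel pair
is `R ∩ R°`, and regularity allows the order axioms and the universal property to be checked on
covers.

*Partial morphisms.* By extensivity, partial morphisms `X ⇀ Y` with complemented domain correspond
to total morphisms from `X` to `maybe Y`, the coproduct of `Y` and the terminal preorder
(`PaPreOrd.exists_ofMaybe_eq`, `PaPreOrd.ofMaybe_injective`): every partial morphism is a total one
followed by the partial inverse `unjust Y` of the inclusion `just Y`. Under this correspondence,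
trivial partial morphisms become trivial morphisms, and coproduct decompositions remain coproduct
decompositions. Two partial morphisms are related by the congruence of the stable category exactly
when they agree on one summand of a decomposition of `X` and are both trivial on the other
(`PaPreOrd.stableRel_iff`). In this form it is seen to be an equivalence relation compatible with
composition, and the zero morphisms of the stable category are seen to be the classes of the trivial
partial morphisms.

A short exact sequence of preorders remains exact in the stable category
(`isShortExactSeq_stabFunctor_map`). For the kernel, a lift is found on the domain of a
representative. For the cokernel `g : Y ⟶ Z`, the existence of a factorization is that for morphisms
into `maybe W`. For uniqueness, a decomposition of `Y` is classified by a morphism to the coproduct of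
two points; this is trivial, so it factors through `g`, and the decomposition of `Y` is induced by
one of `Z`. The torsion theory of the stable category follows from the pretorsion theory of preorders.

A torsion theory functor `G` sends trivial morphisms to zero. If it also preserves finite coproducts,
its extension to the stable category is forced on `unjust Y`: it is the identity on the summand
`G Y` of `G (maybe Y)` and zero on the other, because the restriction of `unjust Y` to the added
point factors through the initial object. Conversely these values define a functor on partial
morphisms that identifies stably equal ones, as both agree after restriction to each summand of the
decomposition. It preserves exactness of canonical sequences because every canonical sequence in
the stable category is isomorphic to the image of one of preorders.
-/

/-! ### Equivalence relations, partial orders and trivial morphisms via generalized elements -/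

namespace InternalPreorder

section Elements

variable {C : Type u} [Category.{v} C]

lemma exists_refl (X : InternalPreorder C) :
    ∃ r : X.carrier ⟶ X.rel, r ≫ X.p₁ = 𝟙 _ ∧ r ≫ X.p₂ = 𝟙 _ :=
  ⟨X.refl.some.r, X.refl.some.reflexivity₁, X.refl.some.reflexivity₂⟩

lemma isEquivalence_iff (X : InternalPreorder C) :
    isEquivalence C X ↔ ∃ s : X.rel ⟶ X.rel, s ≫ X.p₁ = X.p₂ ∧ s ≫ X.p₂ = X.p₁ :=
  ⟨fun ⟨h⟩ => ⟨h.s, h.symmetry₁, h.symmetry₂⟩, fun ⟨s, h₁, h₂⟩ =>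
    ⟨{ right_cancellation := X.isRel.right_cancellation
       s := s, symmetry₁ := h₁, symmetry₂ := h₂ }⟩⟩

lemma relSubobject_factors_iff [HasBinaryProducts C] (X : InternalPreorder C) {T : C}
    (g : T ⟶ X.carrier ⨯ X.carrier) : X.relSubobject.Factors g ↔
      ∃ a : T ⟶ X.rel, a ≫ X.p₁ = g ≫ prod.fst ∧ a ≫ X.p₂ = g ≫ prod.snd :=
  ⟨fun ⟨(a : T ⟶ X.rel), (ha : a ≫ prod.lift X.p₁ X.p₂ = g)⟩ =>
      ⟨a, by rw [← ha, Category.assoc, prod.lift_fst], by rw [← ha, Category.assoc, prod.lift_snd]⟩,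
    fun ⟨a, h₁, h₂⟩ => ⟨a, show a ≫ prod.lift X.p₁ X.p₂ = g from Limits.prod.hom_ext
      (by rw [Category.assoc, prod.lift_fst, h₁]) (by rw [Category.assoc, prod.lift_snd, h₂])⟩⟩

lemma opRelSubobject_factors_iff [HasBinaryProducts C] (X : InternalPreorder C) {T : C}
    (g : T ⟶ X.carrier ⨯ X.carrier) : X.opRelSubobject.Factors g ↔
      ∃ a : T ⟶ X.rel, a ≫ X.p₂ = g ≫ prod.fst ∧ a ≫ X.p₁ = g ≫ prod.snd :=
  ⟨fun ⟨(a : T ⟶ X.rel), (ha : a ≫ prod.lift X.p₂ X.p₁ = g)⟩ =>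
      ⟨a, by rw [← ha, Category.assoc, prod.lift_fst], by rw [← ha, Category.assoc, prod.lift_snd]⟩,
    fun ⟨a, h₁, h₂⟩ => ⟨a, show a ≫ prod.lift X.p₂ X.p₁ = g from Limits.prod.hom_ext
      (by rw [Category.assoc, prod.lift_fst, h₁]) (by rw [Category.assoc, prod.lift_snd, h₂])⟩⟩

lemma mk_diag_factors_iff [HasBinaryProducts C] {A T : C} (g : T ⟶ A ⨯ A) :
    (Subobject.mk (diag A)).Factors g ↔ g ≫ prod.fst = g ≫ prod.snd :=
  ⟨fun ⟨(a : T ⟶ A), (ha : a ≫ prod.lift (𝟙 A) (𝟙 A) = g)⟩ => by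
      rw [← ha, Category.assoc, Category.assoc, prod.lift_fst, prod.lift_snd],
    fun h => ⟨g ≫ prod.fst, show (g ≫ prod.fst) ≫ prod.lift (𝟙 A) (𝟙 A) = g from
      Limits.prod.hom_ext (by rw [Category.assoc, prod.lift_fst, Category.comp_id])
        (by rw [Category.assoc, prod.lift_snd, Category.comp_id, h])⟩⟩

lemma subobject_le_iff_factors {A : C} (P Q : Subobject A) :
    P ≤ Q ↔ ∀ ⦃T : C⦄ (g : T ⟶ A), P.Factors g → Q.Factors g :=
  ⟨fun h _ _ hg => Subobject.factors_of_le _ h hg, fun h =>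
    Subobject.le_of_comm (Q.factorThru P.arrow (h _ (Subobject.factors_self P)))
      (Subobject.factorThru_arrow _ _ _)⟩

/-- A preorder is a partial order exactly when its generalized elements are antisymmetric. -/
lemma isPartialOrder_iff [HasBinaryProducts C] [HasPullbacks C] (X : InternalPreorder C) :
    isPartialOrder C X ↔ ∀ ⦃T : C⦄ (a b : T ⟶ X.rel), a ≫ X.p₁ = b ≫ X.p₂ →
      a ≫ X.p₂ = b ≫ X.p₁ → a ≫ X.p₁ = a ≫ X.p₂ := by
  obtain ⟨r, hr₁, hr₂⟩ := X.exists_refl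
  change X.relSubobject ⊓ X.opRelSubobject = Subobject.mk (diag X.carrier) ↔ _
  simp only [le_antisymm_iff, subobject_le_iff_factors, Subobject.inf_factors,
    relSubobject_factors_iff, opRelSubobject_factors_iff, mk_diag_factors_iff]
  constructor
  · rintro ⟨h, -⟩ T a b h₁ h₂
    have := h (prod.lift (a ≫ X.p₁) (a ≫ X.p₂))
      ⟨⟨a, (prod.lift_fst _ _).symm, (prod.lift_snd _ _).symm⟩,
        ⟨b, by rw [prod.lift_fst, h₁], by rw [prod.lift_snd, h₂]⟩⟩
    rwa [prod.lift_fst, prod.lift_snd] at this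
  · refine fun h => ⟨fun T g ⟨⟨a, a₁, a₂⟩, ⟨b, b₁, b₂⟩⟩ => ?_,
      fun T g hg => ⟨⟨(g ≫ prod.fst) ≫ r, ?_, ?_⟩, ⟨(g ≫ prod.fst) ≫ r, ?_, ?_⟩⟩⟩
    · rw [← a₁, ← a₂]
      exact h a b (a₁.trans b₁.symm) (a₂.trans b₂.symm)
    all_goals simp [hr₁, hr₂, hg]

lemma isEquivalence_discrete [HasPullbacks C] (A : C) : isEquivalence C (discrete A) :=
  (isEquivalence_iff _).2 ⟨𝟙 A, Category.id_comp _, Category.id_comp _⟩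

variable [HasBinaryProducts C] [HasPullbacks C]

lemma isPartialOrder_discrete (A : C) : isPartialOrder C (discrete A) :=
  (isPartialOrder_iff _).2 fun _ _ _ _ _ => rfl

lemma isTrivial_discrete (A : C) : isTrivial C (discrete A) :=
  ⟨isEquivalence_discrete A, isPartialOrder_discrete A⟩

lemma comp_eq_of_isEquivalence_of_isPartialOrder {X Y : InternalPreorder C} (f : X ⟶ Y)
    (hX : isEquivalence C X) (hY : isPartialOrder C Y) : X.p₁ ≫ f.map = X.p₂ ≫ f.map := by
  obtain ⟨s, h₁, h₂⟩ := (isEquivalence_iff X).1 hX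
  have := (isPartialOrder_iff Y).1 hY f.mapRel (s ≫ f.mapRel)
    (by rw [f.comm₁, Category.assoc, f.comm₂, reassoc_of% h₂])
    (by rw [f.comm₂, Category.assoc, f.comm₁, reassoc_of% h₁])
  rwa [f.comm₁, f.comm₂] at this

/-- A morphism of preorders is trivial exactly when it coequalizes the two legs of the relation of
its domain: it then factors through the discrete preorder on the carrier of its codomain. -/
lemma isTrivialMor_iff {X Y : InternalPreorder C} (f : X ⟶ Y) :
    IsTrivialMor (isTrivial C) f ↔ X.p₁ ≫ f.map = X.p₂ ≫ f.map := by
  constructor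
  · rintro ⟨W, a, b, hW, rfl⟩
    have hX := comp_eq_of_isEquivalence_of_isPartialOrder (𝟙 W) hW.1 hW.2
    rw [id_map, Category.comp_id, Category.comp_id] at hX
    rw [comp_map, ← Category.assoc, ← Category.assoc, ← a.comm₁, ← a.comm₂, hX]
  · intro h
    exact ⟨discrete Y.carrier, Hom.mk (Y := discrete Y.carrier) f.map (X.p₁ ≫ f.map)
      (Category.comp_id _) ((Category.comp_id _).trans h), discreteHom (𝟙 _), isTrivial_discrete _,
      hom_ext (Category.comp_id _)⟩

lemma isTrivialMor_of_isEquivalence_of_isPartialOrder {X Y : InternalPreorder C} (f : X ⟶ Y)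
    (hX : isEquivalence C X) (hY : isPartialOrder C Y) : IsTrivialMor (isTrivial C) f :=
  (isTrivialMor_iff f).2 (comp_eq_of_isEquivalence_of_isPartialOrder f hX hY)

lemma isEquivalence_of_iso {X Y : InternalPreorder C} (e : X ≅ Y) (h : isEquivalence C X) :
    isEquivalence C Y := by
  obtain ⟨s, h₁, h₂⟩ := (isEquivalence_iff X).1 h
  have he : e.inv.map ≫ e.hom.map = 𝟙 _ := congrArg Hom.map e.inv_hom_id
  refine (isEquivalence_iff Y).2 ⟨e.inv.mapRel ≫ s ≫ e.hom.mapRel, ?_, ?_⟩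
  · rw [Category.assoc, Category.assoc, e.hom.comm₁, reassoc_of% h₁, e.inv.comm₂', he,
      Category.comp_id]
  · rw [Category.assoc, Category.assoc, e.hom.comm₂, reassoc_of% h₂, e.inv.comm₁', he,
      Category.comp_id]

lemma isPartialOrder_of_iso {X Y : InternalPreorder C} (e : X ≅ Y) (h : isPartialOrder C X) :
    isPartialOrder C Y := by
  have hm : e.inv.map ≫ e.hom.map = 𝟙 _ := congrArg Hom.map e.inv_hom_id
  refine (isPartialOrder_iff Y).2 fun T a b h₁ h₂ => ?_
  have := (isPartialOrder_iff X).1 h (a ≫ e.inv.mapRel) (b ≫ e.inv.mapRel)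
    (by rw [Category.assoc, Category.assoc, e.inv.comm₁, e.inv.comm₂, reassoc_of% h₁])
    (by rw [Category.assoc, Category.assoc, e.inv.comm₁, e.inv.comm₂, reassoc_of% h₂])
  rw [Category.assoc, Category.assoc, e.inv.comm₁, e.inv.comm₂] at this
  simpa [hm] using congrArg (· ≫ e.hom.map) this

end Elements

end InternalPreorder

/-! ### Kernels and cokernels relative to an ideal of trivial morphisms -/

section RelativeKernels

variable {A : Type u₁} [Category.{v₁} A] {Z : ObjectProperty A} {X Y W V : A}

lemma IsTrivialMor.comp_left {g : Y ⟶ W} (h : IsTrivialMor Z g) (f : X ⟶ Y) :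
    IsTrivialMor Z (f ≫ g) := by
  obtain ⟨U, a, b, hU, rfl⟩ := h
  exact ⟨U, f ≫ a, b, hU, Category.assoc _ _ _⟩

lemma IsTrivialMor.comp_right {f : X ⟶ Y} (h : IsTrivialMor Z f) (g : Y ⟶ W) :
    IsTrivialMor Z (f ≫ g) := by
  obtain ⟨U, a, b, hU, rfl⟩ := h
  exact ⟨U, a, b ≫ g, hU, (Category.assoc _ _ _).symm⟩

lemma IsZKernel.mono {k : X ⟶ Y} {f : Y ⟶ W} (h : IsZKernel Z k f) : Mono k where
  right_cancellation a b e :=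
    (h.2 (b ≫ k) (by rw [Category.assoc]; exact h.1.comp_left b)).unique e rfl

lemma IsZCokernel.epi {f : X ⟶ Y} {q : Y ⟶ W} (h : IsZCokernel Z f q) : Epi q where
  left_cancellation a b e :=
    (h.2 (q ≫ b) (by rw [← Category.assoc]; exact h.1.comp_right b)).unique e rfl

/-- Composition with a `Z`-kernel reflects triviality: if `a ≫ k` factors through `U` in `Z`, then
so does `a`, as the second factor `U ⟶ Y` lifts along `k`. -/
lemma IsZKernel.trivial_of_comp {k : X ⟶ Y} {f : Y ⟶ W} (h : IsZKernel Z k f) {a : V ⟶ X}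
    (ha : IsTrivialMor Z (a ≫ k)) : IsTrivialMor Z a := by
  obtain ⟨U, c, d, hU, e⟩ := ha
  obtain ⟨d', hd, -⟩ := h.2 d ⟨U, 𝟙 U, d ≫ f, hU, Category.id_comp _⟩
  have := h.mono
  exact ⟨U, c, d', hU, by rw [← cancel_mono k, Category.assoc, hd, e]⟩

lemma IsZCokernel.trivial_of_comp {f : X ⟶ Y} {q : Y ⟶ W} (h : IsZCokernel Z f q) {a : W ⟶ V}
    (ha : IsTrivialMor Z (q ≫ a)) : IsTrivialMor Z a := by
  obtain ⟨U, c, d, hU, e⟩ := ha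
  obtain ⟨c', hc, -⟩ := h.2 c ⟨U, f ≫ c, 𝟙 U, hU, Category.comp_id _⟩
  have := h.epi
  exact ⟨U, c', d, hU, by rw [← cancel_epi q, reassoc_of% hc, e]⟩

/-- Short `Z`-exact sequences with the same middle term and ends in `T` and `F` are isomorphic. -/
lemma IsShortZExact.exists_iso {T F : ObjectProperty A}
    (h₀ : ∀ ⦃X Y : A⦄ (f : X ⟶ Y), T X → F Y → IsTrivialMor Z f) {X₁ X₂ X X₁' X₂' : A}
    {f : X₁ ⟶ X} {g : X ⟶ X₂} {f' : X₁' ⟶ X} {g' : X ⟶ X₂'} (h : IsShortZExact Z f g)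
    (h' : IsShortZExact Z f' g') (hT : T X₁) (hF : F X₂) (hT' : T X₁') (hF' : F X₂') :
    ∃ (a : X₁ ≅ X₁') (b : X₂ ≅ X₂'), a.hom ≫ f' = f ∧ g ≫ b.hom = g' := by
  have := h.1.mono
  have := h'.1.mono
  have := h.2.epi
  have := h'.2.epi
  obtain ⟨a, ha, -⟩ := h'.1.2 f (h₀ _ hT hF')
  obtain ⟨a', ha', -⟩ := h.1.2 f' (h₀ _ hT' hF)
  obtain ⟨b, hb, -⟩ := h.2.2 g' (h₀ _ hT hF')
  obtain ⟨b', hb', -⟩ := h'.2.2 g (h₀ _ hT' hF)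
  refine ⟨⟨a, a', ?_, ?_⟩, ⟨b, b', ?_, ?_⟩, ha, hb⟩
  · rw [← cancel_mono f, Category.assoc, ha', ha, Category.id_comp]
  · rw [← cancel_mono f', Category.assoc, ha, ha', Category.id_comp]
  · rw [← cancel_epi g, reassoc_of% hb, hb', Category.comp_id]
  · rw [← cancel_epi g', reassoc_of% hb', hb, Category.comp_id]

/-- Short exact sequences in elementary terms. -/
lemma isShortExactSeq_iff [HasZeroMorphisms A] {f : X ⟶ Y} {g : Y ⟶ W} :
    IsShortExactSeq f g ↔ f ≫ g = 0 ∧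
      (∀ ⦃V : A⦄ (l : V ⟶ Y), l ≫ g = 0 → ∃! l' : V ⟶ X, l' ≫ f = l) ∧
      (∀ ⦃V : A⦄ (l : Y ⟶ V), f ≫ l = 0 → ∃! l' : W ⟶ V, g ≫ l' = l) := by
  constructor
  · rintro ⟨w, ⟨hf⟩, ⟨hg⟩⟩
    refine ⟨w, fun V l hl => ?_, fun V l hl => ?_⟩
    · obtain ⟨l', h⟩ := KernelFork.IsLimit.lift' hf l hl
      exact ⟨l', h, fun m hm => Fork.IsLimit.hom_ext hf (hm.trans h.symm)⟩
    · obtain ⟨l', h⟩ := CokernelCofork.IsColimit.desc' hg l hl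
      exact ⟨l', h, fun m hm => Cofork.IsColimit.hom_ext hg (hm.trans h.symm)⟩
  · rintro ⟨w, hf, hg⟩
    choose a ha ha' using hf
    choose b hb hb' using hg
    exact ⟨w, ⟨KernelFork.IsLimit.ofι f w (fun l hl => a l hl) (fun l hl => ha l hl)
        fun l hl m hm => ha' l hl m hm⟩,
      ⟨CokernelCofork.IsColimit.ofπ g w (fun l hl => b l hl) (fun l hl => hb l hl)
        fun l hl m hm => hb' l hl m hm⟩⟩

lemma IsShortExactSeq.of_iso [HasZeroMorphisms A] {X' W' : A} {f : X ⟶ Y} {g : Y ⟶ W}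
    (h : IsShortExactSeq f g) (a : X' ≅ X) (b : W ≅ W') :
    IsShortExactSeq (a.hom ≫ f) (g ≫ b.hom) := by
  rw [isShortExactSeq_iff] at h ⊢
  obtain ⟨w, hf, hg⟩ := h
  refine ⟨by rw [Category.assoc, reassoc_of% w, zero_comp, comp_zero], fun V l hl => ?_,
    fun V l hl => ?_⟩
  · obtain ⟨l', h₁, h₂⟩ := hf l (by rw [← cancel_mono b.hom, Category.assoc, hl, zero_comp])
    exact ⟨l' ≫ a.inv, by simpa using h₁, fun m hm => by
      simpa using congrArg (· ≫ a.inv) (h₂ (m ≫ a.hom) (by simpa using hm))⟩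
  · obtain ⟨l', h₁, h₂⟩ := hg l (by rw [← cancel_epi a.hom, ← Category.assoc, hl, comp_zero])
    exact ⟨b.inv ≫ l', by simpa using h₁, fun m hm => by
      simpa using congrArg (b.inv ≫ ·) (h₂ (b.hom ≫ m) (by simpa using hm))⟩

end RelativeKernels

/-! ### The pretorsion theory of equivalence relations and partial orders -/

namespace InternalPreorder

section Canonical

variable {C : Type u} [Category.{v} C] [HasBinaryProducts C] [HasPullbacks C]

/-- The intersection of the relation of a preorder with its opposite. -/
noncomputable def symRel (X : InternalPreorder C) : C :=
  pullback (prod.lift X.p₁ X.p₂) (prod.lift X.p₂ X.p₁)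

/-- First leg of the symmetric part of the relation of a preorder. -/
noncomputable def symFst (X : InternalPreorder C) : symRel X ⟶ X.carrier :=
  pullback.fst (prod.lift X.p₁ X.p₂) (prod.lift X.p₂ X.p₁) ≫ X.p₁

/-- Second leg of the symmetric part of the relation of a preorder. -/
noncomputable def symSnd (X : InternalPreorder C) : symRel X ⟶ X.carrier :=
  pullback.fst (prod.lift X.p₁ X.p₂) (prod.lift X.p₂ X.p₁) ≫ X.p₂

/-- A generalized element of the symmetric part is a pair of elements related in both directions. -/
lemma symRel_elim (X : InternalPreorder C) {T : C} (c : T ⟶ symRel X) :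
    ∃ a b : T ⟶ X.rel, a ≫ X.p₁ = c ≫ symFst X ∧ a ≫ X.p₂ = c ≫ symSnd X ∧
      b ≫ X.p₁ = c ≫ symSnd X ∧ b ≫ X.p₂ = c ≫ symFst X := by
  have e := pullback.condition (f := prod.lift X.p₁ X.p₂) (g := prod.lift X.p₂ X.p₁)
  have e₁ := congrArg (· ≫ prod.fst) e
  have e₂ := congrArg (· ≫ prod.snd) e
  simp only [Category.assoc, prod.lift_fst, prod.lift_snd] at e₁ e₂
  exact ⟨c ≫ pullback.fst (prod.lift X.p₁ X.p₂) (prod.lift X.p₂ X.p₁),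
    c ≫ pullback.snd (prod.lift X.p₁ X.p₂) (prod.lift X.p₂ X.p₁), Category.assoc _ _ _,
    Category.assoc _ _ _, (Category.assoc _ _ _).trans (congrArg (c ≫ ·) e₂.symm),
    (Category.assoc _ _ _).trans (congrArg (c ≫ ·) e₁.symm)⟩

lemma symRel_intro (X : InternalPreorder C) {T : C} (a b : T ⟶ X.rel) (h₁ : a ≫ X.p₁ = b ≫ X.p₂)
    (h₂ : a ≫ X.p₂ = b ≫ X.p₁) :
    ∃ c : T ⟶ symRel X, c ≫ symFst X = a ≫ X.p₁ ∧ c ≫ symSnd X = a ≫ X.p₂ :=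
  ⟨pullback.lift a b (Limits.prod.hom_ext (by simp [prod.lift_fst, h₁])
    (by simp [prod.lift_snd, h₂])), pullback.lift_fst_assoc _ _ _ _,
      pullback.lift_fst_assoc _ _ _ _⟩

lemma symRel_ext (X : InternalPreorder C) {T : C} (a b : T ⟶ symRel X)
    (h₁ : a ≫ symFst X = b ≫ symFst X) (h₂ : a ≫ symSnd X = b ≫ symSnd X) : a = b := by
  have : Mono (prod.lift X.p₂ X.p₁) := ⟨fun a b h => X.rel_ext
    (by simpa [prod.lift_snd] using congrArg (· ≫ prod.snd) h)
    (by simpa [prod.lift_fst] using congrArg (· ≫ prod.fst) h)⟩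
  exact (cancel_mono (pullback.fst (prod.lift X.p₁ X.p₂) (prod.lift X.p₂ X.p₁))).1
    (X.rel_ext ((Category.assoc _ _ _).trans (h₁.trans (Category.assoc _ _ _).symm))
      ((Category.assoc _ _ _).trans (h₂.trans (Category.assoc _ _ _).symm)))

/-- The largest equivalence relation contained in a preorder `X`, on the same carrier. -/
noncomputable def torsionPart (X : InternalPreorder C) : InternalPreorder C :=
  ofElements X.carrier (symRel X) (symFst X) (symSnd X) (fun T a b => symRel_ext X a b)
    (by
      obtain ⟨r, h₁, h₂⟩ := X.exists_refl
      obtain ⟨c, c₁, c₂⟩ := symRel_intro X r r (h₁.trans h₂.symm) (h₂.trans h₁.symm)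
      exact ⟨c, c₁.trans h₁, c₂.trans h₂⟩)
    (fun T a b h => by
      obtain ⟨a₁, a₂, h₁, h₂, h₃, h₄⟩ := symRel_elim X a
      obtain ⟨b₁, b₂, k₁, k₂, k₃, k₄⟩ := symRel_elim X b
      obtain ⟨c, c₁, c₂⟩ := X.exists_trans a₁ b₁ (by rw [h₂, k₁, h])
      obtain ⟨d, d₁, d₂⟩ := X.exists_trans b₂ a₂ (by rw [h₃, k₄, h])
      obtain ⟨e, e₁, e₂⟩ := symRel_intro X c d (by rw [c₁, d₂, h₁, h₄]) (by rw [c₂, d₁, k₂, k₃])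
      exact ⟨e, by rw [e₁, c₁, h₁], by rw [e₂, c₂, k₂]⟩)

/-- The inclusion of the largest equivalence relation contained in `X`; it is the identity on
carriers. -/
noncomputable def torsionι (X : InternalPreorder C) : torsionPart X ⟶ X :=
  Hom.mk (X := torsionPart X) (𝟙 X.carrier)
    (pullback.fst (prod.lift X.p₁ X.p₂) (prod.lift X.p₂ X.p₁)) (Category.comp_id _).symm
    (Category.comp_id _).symm

lemma isEquivalence_torsionPart (X : InternalPreorder C) : isEquivalence C (torsionPart X) := by
  obtain ⟨a, b, a₁, a₂, b₁, b₂⟩ := symRel_elim X (𝟙 _)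
  obtain ⟨s, s₁, s₂⟩ := symRel_intro X b a (b₁.trans a₂.symm) (b₂.trans a₁.symm)
  exact (isEquivalence_iff _).2 ⟨s, s₁.trans (b₁.trans (Category.id_comp _)),
    s₂.trans (b₂.trans (Category.id_comp _))⟩

lemma isTrivialMor_torsionι_comp_iff {X Y : InternalPreorder C} (f : X ⟶ Y) :
    IsTrivialMor (isTrivial C) (torsionι X ≫ f) ↔ symFst X ≫ f.map = symSnd X ≫ f.map := by
  have h : (torsionι X ≫ f).map = f.map := Category.id_comp _
  rw [isTrivialMor_iff, h]
  rfl

end Canonical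

section Regular

variable {C : Type u} [Category.{v} C] [Regular C]

/-- Generalized elements lift along a regular epimorphism after passing to a cover. -/
lemma exists_cover {R S T : C} (e : R ⟶ S) [IsRegularEpi e] (a : T ⟶ S) :
    ∃ (T' : C) (t : T' ⟶ T) (a' : T' ⟶ R), IsRegularEpi t ∧ a' ≫ e = t ≫ a :=
  ⟨_, pullback.snd e a, pullback.fst e a, inferInstance, pullback.condition⟩

/-- Membership in a relation may be checked on a cover. -/
lemma exists_rel_of_cover {S Q T T' : C} {s₁ s₂ : S ⟶ Q}
    (hm : ∀ ⦃T : C⦄ (a b : T ⟶ S), a ≫ s₁ = b ≫ s₁ → a ≫ s₂ = b ≫ s₂ → a = b)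
    (t : T' ⟶ T) [StrongEpi t] (c : T' ⟶ S) (x y : T ⟶ Q) (h₁ : c ≫ s₁ = t ≫ x)
    (h₂ : c ≫ s₂ = t ≫ y) : ∃ d : T ⟶ S, d ≫ s₁ = x ∧ d ≫ s₂ = y := by
  have : Mono (prod.lift s₁ s₂) := ⟨fun a b h => hm a b
    (by simpa [prod.lift_fst] using congrArg (· ≫ prod.fst) h)
    (by simpa [prod.lift_snd] using congrArg (· ≫ prod.snd) h)⟩
  have sq : CommSq c t (prod.lift s₁ s₂) (prod.lift x y) := ⟨Limits.prod.hom_ext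
    (by rw [Category.assoc, Category.assoc, prod.lift_fst, prod.lift_fst, h₁])
    (by rw [Category.assoc, Category.assoc, prod.lift_snd, prod.lift_snd, h₂])⟩
  have h := sq.fac_right
  exact ⟨sq.lift,
    by simpa only [Category.assoc, prod.lift_fst] using congrArg (· ≫ prod.fst) h,
    by simpa only [Category.assoc, prod.lift_snd] using congrArg (· ≫ prod.snd) h⟩

lemma exists_regularEpi_mono_fac {X Y : C} (f : X ⟶ Y) :
    ∃ (S : C) (e : X ⟶ S) (m : S ⟶ Y), IsRegularEpi e ∧ Mono m ∧ e ≫ m = f :=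
  ⟨_, _, _, inferInstanceAs (IsRegularEpi (Regular.strongEpiMonoFactorisation f).e),
    (Regular.strongEpiMonoFactorisation f).m_mono, (Regular.strongEpiMonoFactorisation f).fac⟩

lemma exists_regularEpi_kernelPair {R X Q : C} {p₁ p₂ : R ⟶ X} (q : X ⟶ Q)
    (h : IsKernelPair q p₁ p₂) : ∃ (Q' : C) (q' : X ⟶ Q'), IsRegularEpi q' ∧
      IsKernelPair q' p₁ p₂ := by
  obtain ⟨S, e, m, he, hm, rfl⟩ := exists_regularEpi_mono_fac q
  exact ⟨S, e, he, IsKernelPair.cancel_right_of_mono h⟩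

/-- The partial order associated with a preorder `X`: the quotient `q` of the carrier of `X` by the
largest equivalence relation contained in `X`, ordered by the image of the relation of `X`. -/
lemma exists_torsionFree {X : InternalPreorder C} {Q : C} (q : X.carrier ⟶ Q) [IsRegularEpi q]
    (hq : IsKernelPair q (symFst X) (symSnd X)) :
    ∃ (Y : InternalPreorder C) (g : X ⟶ Y), isPartialOrder C Y ∧ IsRegularEpi g.map ∧
      IsRegularEpi g.mapRel ∧ IsKernelPair g.map (symFst X) (symSnd X) := by
  obtain ⟨S, e, m, he, hm, fac⟩ := exists_regularEpi_mono_fac (prod.lift (X.p₁ ≫ q) (X.p₂ ≫ q))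
  have f₁ : e ≫ m ≫ prod.fst = X.p₁ ≫ q := by rw [← Category.assoc, fac, prod.lift_fst]
  have f₂ : e ≫ m ≫ prod.snd = X.p₂ ≫ q := by rw [← Category.assoc, fac, prod.lift_snd]
  have hm : ∀ ⦃T : C⦄ (a b : T ⟶ S), a ≫ m ≫ prod.fst = b ≫ m ≫ prod.fst →
      a ≫ m ≫ prod.snd = b ≫ m ≫ prod.snd → a = b := fun T a b h₁ h₂ => by
    rw [← cancel_mono m]
    exact Limits.prod.hom_ext (by simpa using h₁) (by simpa using h₂)
  -- Two elements of `X` identified by `q` are related.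
  have key : ∀ ⦃T : C⦄ (x y : T ⟶ X.carrier), x ≫ q = y ≫ q →
      ∃ a : T ⟶ X.rel, a ≫ X.p₁ = x ∧ a ≫ X.p₂ = y := fun T x y h => by
    obtain ⟨a, b, a₁, a₂, -, -⟩ := symRel_elim X (hq.lift x y h)
    exact ⟨a, a₁.trans (hq.lift_fst _ _ _), a₂.trans (hq.lift_snd _ _ _)⟩
  have comp : ∀ ⦃T : C⦄ (a b : T ⟶ X.rel), a ≫ X.p₂ ≫ q = b ≫ X.p₁ ≫ q →
      ∃ c : T ⟶ X.rel, c ≫ X.p₁ = a ≫ X.p₁ ∧ c ≫ X.p₂ = b ≫ X.p₂ := fun T a b h => by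
    obtain ⟨c, c₁, c₂⟩ := key (a ≫ X.p₂) (b ≫ X.p₁) (by simpa using h)
    obtain ⟨d, d₁, d₂⟩ := X.exists_trans a c c₁.symm
    obtain ⟨d', d₁', d₂'⟩ := X.exists_trans d b (d₂.trans c₂)
    exact ⟨d', d₁'.trans d₁, d₂'⟩
  -- Two elements of the image of the relation lift simultaneously after passing to a cover.
  have cover : ∀ ⦃T : C⦄ (a b : T ⟶ S), ∃ (T' : C) (t : T' ⟶ T) (a' b' : T' ⟶ X.rel),
      StrongEpi t ∧ a' ≫ e = t ≫ a ∧ b' ≫ e = t ≫ b := fun T a b => by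
    obtain ⟨T₁, t₁, a₁, ht₁, ha₁⟩ := exists_cover e a
    obtain ⟨T₂, t₂, b₂, ht₂, hb₂⟩ := exists_cover e (t₁ ≫ b)
    exact ⟨T₂, t₂ ≫ t₁, t₂ ≫ a₁, b₂, strongEpi_comp _ _,
      by rw [Category.assoc, Category.assoc, ha₁], by rw [Category.assoc, hb₂]⟩
  let Y : InternalPreorder C := ofElements Q S (m ≫ prod.fst) (m ≫ prod.snd) hm
    (by
      obtain ⟨r, hr₁, hr₂⟩ := X.exists_refl
      obtain ⟨d, h₁, h₂⟩ := exists_rel_of_cover hm q (r ≫ e) (𝟙 Q) (𝟙 Q)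
        (by rw [Category.assoc, f₁, reassoc_of% hr₁, Category.comp_id])
        (by rw [Category.assoc, f₂, reassoc_of% hr₂, Category.comp_id])
      exact ⟨d, h₁, h₂⟩)
    (fun T a b h => by
      obtain ⟨T', t, a', b', ht, ha, hb⟩ := cover a b
      obtain ⟨c, c₁, c₂⟩ := comp a' b' (by rw [← f₁, ← f₂, reassoc_of% ha, reassoc_of% hb, h])
      exact exists_rel_of_cover hm t (c ≫ e) (a ≫ m ≫ prod.fst) (b ≫ m ≫ prod.snd)
        (by rw [Category.assoc, f₁, reassoc_of% c₁, ← f₁, reassoc_of% ha])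
        (by rw [Category.assoc, f₂, reassoc_of% c₂, ← f₂, reassoc_of% hb]))
  refine ⟨Y, Hom.mk (Y := Y) q e f₁ f₂, (isPartialOrder_iff Y).2 ?_,
    inferInstanceAs (IsRegularEpi q), he, hq⟩
  intro T (a : T ⟶ S) (b : T ⟶ S) (h₁ : a ≫ m ≫ prod.fst = b ≫ m ≫ prod.snd)
    (h₂ : a ≫ m ≫ prod.snd = b ≫ m ≫ prod.fst)
  change a ≫ m ≫ prod.fst = a ≫ m ≫ prod.snd
  obtain ⟨T', t, a', b', ht, ha, hb⟩ := cover a b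
  -- On the cover, `a'` relates `x` to `y`, and `b'` relates an element equivalent to `y` to one
  -- equivalent to `x`, so that `y` is also related to `x`.
  obtain ⟨c, c₁, c₂⟩ := key (a' ≫ X.p₂) (b' ≫ X.p₁) (by
    rw [Category.assoc, Category.assoc, ← f₁, ← f₂, reassoc_of% ha, reassoc_of% hb, h₂])
  obtain ⟨d, d₁, d₂⟩ := key (b' ≫ X.p₂) (a' ≫ X.p₁) (by
    rw [Category.assoc, Category.assoc, ← f₁, ← f₂, reassoc_of% ha, reassoc_of% hb, h₁])
  obtain ⟨y, y₁, y₂⟩ := X.exists_trans c b' c₂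
  obtain ⟨w, w₁, w₂⟩ := X.exists_trans y d (y₂.trans d₁.symm)
  obtain ⟨z, z₁, z₂⟩ := symRel_intro X a' w (by rw [w₂, d₂]) (by rw [w₁, y₁, c₁])
  have hz : a' ≫ X.p₁ ≫ q = a' ≫ X.p₂ ≫ q := by
    rw [← reassoc_of% z₁, ← reassoc_of% z₂, hq.w]
  rw [← cancel_epi t, ← reassoc_of% ha, ← reassoc_of% ha, f₁, f₂, hz]

/-- The canonical short exact sequence of a preorder, provided that its largest equivalence
relation is a kernel pair. -/
lemma isShortZExact_torsionι {X Y : InternalPreorder C} (g : X ⟶ Y) [IsRegularEpi g.map]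
    [IsRegularEpi g.mapRel] (hg : IsKernelPair g.map (symFst X) (symSnd X)) :
    IsShortZExact (isTrivial C) (torsionι X) g := by
  refine ⟨⟨(isTrivialMor_torsionι_comp_iff g).2 hg.w, fun W l hl => ?_⟩,
    ⟨(isTrivialMor_torsionι_comp_iff g).2 hg.w, fun W l hl => ?_⟩⟩
  · rw [isTrivialMor_iff, comp_map] at hl
    refine ⟨Hom.mk (Y := torsionPart X) l.map
      (hg.lift (W.p₁ ≫ l.map) (W.p₂ ≫ l.map) (by simpa using hl))
      (hg.lift_fst _ _ _) (hg.lift_snd _ _ _), hom_ext (Category.comp_id _), fun m hm => hom_ext ?_⟩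
    exact (Category.comp_id _).symm.trans (congrArg Hom.map hm)
  · rw [isTrivialMor_torsionι_comp_iff] at hl
    obtain ⟨d, hd⟩ := IsRegularEpi.exists_of_isKernelPair g.map hg l.map hl
    obtain ⟨e, e₁, e₂⟩ := exists_rel_of_cover W.isRel.right_cancellation g.mapRel l.mapRel
      (Y.p₁ ≫ d) (Y.p₂ ≫ d) (by rw [l.comm₁, ← hd, g.comm₁'])
      (by rw [l.comm₂, ← hd, g.comm₂'])
    refine ⟨Hom.mk d e e₁ e₂, hom_ext hd, fun m hm => hom_ext ?_⟩
    rw [← cancel_epi g.map]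
    exact (congrArg Hom.map hm).trans hd.symm

end Regular

variable {C : Type u} [Category.{v} C] [Pretopos C]

lemma isPretorsionTheory_isEquivalence_isPartialOrder :
    IsPretorsionTheory (isEquivalence C) (isPartialOrder C) where
  replete_torsion := ⟨fun e h => isEquivalence_of_iso e h⟩
  replete_torsionFree := ⟨fun e h => isPartialOrder_of_iso e h⟩
  trivial _ _ f hX hY := isTrivialMor_of_isEquivalence_of_isPartialOrder f hX hY
  exact_seq X := by
    have hE : IsEquivalenceRelation (symFst X) (symSnd X) := by
      obtain ⟨r⟩ := (torsionPart X).refl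
      obtain ⟨s⟩ := isEquivalence_torsionPart X
      obtain ⟨t⟩ := (torsionPart X).trans
      exact ⟨⟨{ toReflexiveRelation := r
                s := s.s, symmetry₁ := s.symmetry₁, symmetry₂ := s.symmetry₂
                c := t.c, isLimit := t.isLimit, t := t.t
                transitivity₁ := t.transitivity₁, transitivity₂ := t.transitivity₂ }⟩⟩
    obtain ⟨Q, q, hq⟩ := Pretopos.effective _ _ hE
    obtain ⟨Q', q', hq', hk⟩ := exists_regularEpi_kernelPair q hq
    obtain ⟨Y, g, hY, h₁, h₂, hg⟩ := exists_torsionFree (X := X) q' hk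
    exact ⟨torsionPart X, Y, torsionι X, g, isEquivalence_torsionPart X, hY,
      isShortZExact_torsionι g hg⟩

end InternalPreorder

namespace InternalPreorder

/-! ### Coproduct decompositions of preorders -/

section Decompositions

variable {C : Type u} [Category.{v} C] [HasPullbacks C] [FinitaryExtensive C]
  {X Y Z W : InternalPreorder C}

lemma isInitial_rel {O : InternalPreorder C} (h : IsInitial O) : Nonempty (IsInitial O.rel) := by
  obtain ⟨h'⟩ := isInitial_carrier h
  have := h'.isIso_to O.p₁
  exact ⟨h'.ofIso (asIso O.p₁).symm⟩

lemma IsDecomp.symm {α : X ⟶ Z} {β : Y ⟶ Z} (h : IsDecomp α β) : IsDecomp β α :=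
  ⟨coprod_symm h.1, coprod_symm h.2⟩

lemma IsDecomp.exists_desc {α : X ⟶ Z} {β : Y ⟶ Z} (h : IsDecomp α β) (f : X ⟶ W) (g : Y ⟶ W) :
    ∃ d : Z ⟶ W, α ≫ d = f ∧ β ≫ d = g := by
  obtain ⟨d, d₁, d₂⟩ := coprod_desc h.1 f.map g.map
  obtain ⟨e, e₁, e₂⟩ := coprod_desc h.2 f.mapRel g.mapRel
  refine ⟨Hom.mk d e (coprod_ext h.2 ?_ ?_) (coprod_ext h.2 ?_ ?_), hom_ext d₁, hom_ext d₂⟩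
  · rw [reassoc_of% e₁, α.comm₁', d₁, f.comm₁]
  · rw [reassoc_of% e₂, β.comm₁', d₂, g.comm₁]
  · rw [reassoc_of% e₁, α.comm₂', d₁, f.comm₂]
  · rw [reassoc_of% e₂, β.comm₂', d₂, g.comm₂]

lemma IsDecomp.hom_ext {α : X ⟶ Z} {β : Y ⟶ Z} (h : IsDecomp α β) {f g : Z ⟶ W}
    (h₁ : α ≫ f = α ≫ g) (h₂ : β ≫ f = β ≫ g) : f = g :=
  InternalPreorder.hom_ext (coprod_ext h.1 (congrArg Hom.map h₁) (congrArg Hom.map h₂))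

lemma IsDecomp.isColimit {α : X ⟶ Z} {β : Y ⟶ Z} (h : IsDecomp α β) :
    Nonempty (IsColimit (BinaryCofan.mk α β)) := by
  choose d d₁ d₂ using fun (s : BinaryCofan X Y) => h.exists_desc s.inl s.inr
  exact ⟨BinaryCofan.isColimitMk d d₁ d₂ fun s m e₁ e₂ =>
    h.hom_ext (e₁.trans (d₁ s).symm) (e₂.trans (d₂ s).symm)⟩

lemma IsDecomp.pbFst {α : X ⟶ Z} {β : Y ⟶ Z} (h : IsDecomp α β) (f : W ⟶ Z) :
    IsDecomp (pbFst f α) (pbFst f β) :=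
  ⟨(extensive_iff h.1 _ _ f.map pullback.condition.symm pullback.condition.symm).2
      ⟨IsPullback.of_hasPullback _ _, IsPullback.of_hasPullback _ _⟩,
    (extensive_iff h.2 _ _ f.mapRel pullback.condition.symm pullback.condition.symm).2
      ⟨IsPullback.of_hasPullback _ _, IsPullback.of_hasPullback _ _⟩⟩

lemma IsDecomp.pbSnd {α : X ⟶ Z} {β : Y ⟶ Z} (h : IsDecomp α β) (f : W ⟶ Z) :
    IsDecomp (pbSnd α f) (pbSnd β f) :=
  ⟨(extensive_iff h.1 _ _ f.map pullback.condition pullback.condition).2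
      ⟨(IsPullback.of_hasPullback _ _).flip, (IsPullback.of_hasPullback _ _).flip⟩,
    (extensive_iff h.2 _ _ f.mapRel pullback.condition pullback.condition).2
      ⟨(IsPullback.of_hasPullback _ _).flip, (IsPullback.of_hasPullback _ _).flip⟩⟩

lemma IsDecomp.isInitial {α : X ⟶ Z} {β : Y ⟶ Z} (h : IsDecomp α β) (f : W ⟶ X) (g : W ⟶ Y)
    (w : f ≫ α = g ≫ β) : Nonempty (IsInitial W) :=
  let ⟨hW⟩ := coprod_disjoint h.1 f.map g.map (congrArg Hom.map w)
  isInitial_of_carrier hW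

lemma coprod_iso_left {A A' B D : C} {i : A ⟶ D} {j : B ⟶ D}
    (h : Nonempty (IsColimit (BinaryCofan.mk i j))) (φ : A' ⟶ A) [IsIso φ] :
    Nonempty (IsColimit (BinaryCofan.mk (φ ≫ i) j)) := by
  refine coprod_of (fun T f g => ?_) (fun T f g h₁ h₂ => coprod_ext h ?_ h₂)
  · obtain ⟨d, d₁, d₂⟩ := coprod_desc h (inv φ ≫ f) g
    exact ⟨d, by rw [Category.assoc, d₁, IsIso.hom_inv_id_assoc], d₂⟩
  · rw [← cancel_epi φ, ← Category.assoc, h₁, Category.assoc]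

lemma IsDecomp.iso_left {X' : InternalPreorder C} {α : X ⟶ Z} {β : Y ⟶ Z} (h : IsDecomp α β)
    (φ : X' ≅ X) : IsDecomp (φ.hom ≫ α) β := by
  have : IsIso φ.hom.map := ⟨φ.inv.map, congrArg Hom.map φ.hom_inv_id,
    congrArg Hom.map φ.inv_hom_id⟩
  have : IsIso φ.hom.mapRel := ⟨φ.inv.mapRel, congrArg Hom.mapRel φ.hom_inv_id,
    congrArg Hom.mapRel φ.inv_hom_id⟩
  exact ⟨coprod_iso_left h.1 φ.hom.map, coprod_iso_left h.2 φ.hom.mapRel⟩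

lemma isDecomp_id_of_isInitial (hY : IsInitial Y) (f : Y ⟶ X) : IsDecomp (𝟙 X) f := by
  obtain ⟨h₁⟩ := isInitial_carrier hY
  obtain ⟨h₂⟩ := isInitial_rel hY
  exact ⟨coprod_of (fun T f g => ⟨f, Category.id_comp f, h₁.hom_ext _ _⟩)
      (fun T f g h _ => by simpa using h),
    coprod_of (fun T f g => ⟨f, Category.id_comp f, h₂.hom_ext _ _⟩)
      (fun T f g h _ => by simpa using h)⟩

/-- A morphism that avoids one summand factors through the other. -/
lemma IsDecomp.exists_lift {α : X ⟶ Z} {β : Y ⟶ Z} (h : IsDecomp α β) (f : W ⟶ Z)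
    (hf : ∀ ⦃T : InternalPreorder C⦄ (a : T ⟶ W) (b : T ⟶ X), a ≫ f = b ≫ α →
      Nonempty (IsInitial T)) : ∃ l : W ⟶ Y, l ≫ β = f := by
  obtain ⟨hI⟩ := hf (InternalPreorder.pbFst f α) (InternalPreorder.pbSnd f α) (pb_isPullback f α).w
  obtain ⟨d, -, hd⟩ := (h.pbFst f).exists_desc (hI.to _) (𝟙 _)
  have hd' : d ≫ InternalPreorder.pbFst f β = 𝟙 W :=
    (h.pbFst f).hom_ext (hI.hom_ext _ _) (by rw [reassoc_of% hd, Category.comp_id])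
  exact ⟨d ≫ InternalPreorder.pbSnd f β, by
    rw [Category.assoc, ← (pb_isPullback f β).w, reassoc_of% hd']⟩

lemma IsDecomp.exists_lift_of_isDecomp {Y' : InternalPreorder C} {α : X ⟶ Z} {β : Y ⟶ Z}
    {β' : Y' ⟶ Z} (h : IsDecomp α β) (h' : IsDecomp α β') : ∃ l : Y' ⟶ Y, l ≫ β = β' :=
  h.exists_lift β' fun _ a b e => h'.symm.isInitial a b e

/-- First summand of a coproduct of preorders. -/
noncomputable def sumInl (X Y : InternalPreorder C) : X ⟶ sum X Y :=
  Hom.mk (Y := sum X Y) coprod.inl coprod.inl (coprod.inl_map _ _) (coprod.inl_map _ _)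

/-- Second summand of a coproduct of preorders. -/
noncomputable def sumInr (X Y : InternalPreorder C) : Y ⟶ sum X Y :=
  Hom.mk (Y := sum X Y) coprod.inr coprod.inr (coprod.inr_map _ _) (coprod.inr_map _ _)

lemma isDecomp_sum (X Y : InternalPreorder C) : IsDecomp (sumInl X Y) (sumInr X Y) :=
  ⟨coprod_standard _ _, coprod_standard _ _⟩

/-- A decomposition of a summand refines the given decomposition. -/
lemma IsDecomp.refine {X' : InternalPreorder C} {e : X ⟶ Y} {n : X' ⟶ Y}
    {i : Y ⟶ Z} {j : W ⟶ Z} (h : IsDecomp e n) (h' : IsDecomp i j) :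
    ∃ d : sum X' W ⟶ Z, IsDecomp (e ≫ i) d ∧ sumInl X' W ≫ d = n ≫ i ∧ sumInr X' W ≫ d = j := by
  obtain ⟨d, d₁, d₂⟩ := (isDecomp_sum X' W).exists_desc (n ≫ i) j
  exact ⟨d, ⟨coprod_assoc h.1 h'.1 (isDecomp_sum X' W).1 (congrArg Hom.map d₁)
      (congrArg Hom.map d₂),
    coprod_assoc h.2 h'.2 (isDecomp_sum X' W).2 (congrArg Hom.mapRel d₁)
      (congrArg Hom.mapRel d₂)⟩, d₁, d₂⟩

lemma coprod_interchange {A B D A₁ A₂ B₁ B₂ P Q : C} {i : A ⟶ D} {j : B ⟶ D} {a₁ : A₁ ⟶ A}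
    {a₂ : A₂ ⟶ A} {b₁ : B₁ ⟶ B} {b₂ : B₂ ⟶ B} {p₁ : A₁ ⟶ P} {p₂ : B₁ ⟶ P} {q₁ : A₂ ⟶ Q}
    {q₂ : B₂ ⟶ Q} (h : Nonempty (IsColimit (BinaryCofan.mk i j)))
    (ha : Nonempty (IsColimit (BinaryCofan.mk a₁ a₂)))
    (hb : Nonempty (IsColimit (BinaryCofan.mk b₁ b₂)))
    (hp : Nonempty (IsColimit (BinaryCofan.mk p₁ p₂)))
    (hq : Nonempty (IsColimit (BinaryCofan.mk q₁ q₂))) {d : P ⟶ D} {e : Q ⟶ D}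
    (d₁ : p₁ ≫ d = a₁ ≫ i) (d₂ : p₂ ≫ d = b₁ ≫ j) (e₁ : q₁ ≫ e = a₂ ≫ i)
    (e₂ : q₂ ≫ e = b₂ ≫ j) : Nonempty (IsColimit (BinaryCofan.mk d e)) := by
  refine coprod_of (fun T f g => ?_) (fun T f g h₁ h₂ => ?_)
  · obtain ⟨s, s₁, s₂⟩ := coprod_desc ha (p₁ ≫ f) (q₁ ≫ g)
    obtain ⟨t, t₁, t₂⟩ := coprod_desc hb (p₂ ≫ f) (q₂ ≫ g)
    obtain ⟨r, r₁, r₂⟩ := coprod_desc h s t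
    refine ⟨r, coprod_ext hp ?_ ?_, coprod_ext hq ?_ ?_⟩
    · rw [reassoc_of% d₁, r₁, s₁]
    · rw [reassoc_of% d₂, r₂, t₁]
    · rw [reassoc_of% e₁, r₁, s₂]
    · rw [reassoc_of% e₂, r₂, t₂]
  · refine coprod_ext h (coprod_ext ha ?_ ?_) (coprod_ext hb ?_ ?_)
    · rw [← reassoc_of% d₁, ← reassoc_of% d₁, h₁]
    · rw [← reassoc_of% e₁, ← reassoc_of% e₁, h₂]
    · rw [← reassoc_of% d₂, ← reassoc_of% d₂, h₁]
    · rw [← reassoc_of% e₂, ← reassoc_of% e₂, h₂]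

/-- Decompositions of the two summands combine to a decomposition of the whole. -/
lemma IsDecomp.interchange {X₁ X₂ Y₁ Y₂ : InternalPreorder C} {α : X ⟶ Z} {β : Y ⟶ Z}
    {a₁ : X₁ ⟶ X} {a₂ : X₂ ⟶ X} {b₁ : Y₁ ⟶ Y} {b₂ : Y₂ ⟶ Y} (h : IsDecomp α β)
    (ha : IsDecomp a₁ a₂) (hb : IsDecomp b₁ b₂) :
    ∃ (d : sum X₁ Y₁ ⟶ Z) (e : sum X₂ Y₂ ⟶ Z), IsDecomp d e ∧
      sumInl X₁ Y₁ ≫ d = a₁ ≫ α ∧ sumInr X₁ Y₁ ≫ d = b₁ ≫ β ∧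
      sumInl X₂ Y₂ ≫ e = a₂ ≫ α ∧ sumInr X₂ Y₂ ≫ e = b₂ ≫ β := by
  obtain ⟨d, d₁, d₂⟩ := (isDecomp_sum X₁ Y₁).exists_desc (a₁ ≫ α) (b₁ ≫ β)
  obtain ⟨e, e₁, e₂⟩ := (isDecomp_sum X₂ Y₂).exists_desc (a₂ ≫ α) (b₂ ≫ β)
  exact ⟨d, e, ⟨coprod_interchange h.1 ha.1 hb.1 (isDecomp_sum X₁ Y₁).1 (isDecomp_sum X₂ Y₂).1
      (congrArg Hom.map d₁) (congrArg Hom.map d₂) (congrArg Hom.map e₁) (congrArg Hom.map e₂),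
    coprod_interchange h.2 ha.2 hb.2 (isDecomp_sum X₁ Y₁).2 (isDecomp_sum X₂ Y₂).2
      (congrArg Hom.mapRel d₁) (congrArg Hom.mapRel d₂) (congrArg Hom.mapRel e₁)
      (congrArg Hom.mapRel e₂)⟩, d₁, d₂, e₁, e₂⟩

variable [HasBinaryProducts C]

lemma IsDecomp.isTrivialMor {α : X ⟶ Z} {β : Y ⟶ Z} (h : IsDecomp α β) {f : Z ⟶ W}
    (h₁ : IsTrivialMor (isTrivial C) (α ≫ f)) (h₂ : IsTrivialMor (isTrivial C) (β ≫ f)) :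
    IsTrivialMor (isTrivial C) f := by
  rw [isTrivialMor_iff, comp_map] at h₁ h₂
  rw [isTrivialMor_iff]
  refine coprod_ext h.2 ?_ ?_
  · rw [α.comm₁', h₁, α.comm₂']
  · rw [β.comm₁', h₂, β.comm₂']

lemma isTrivialMor_of_comp_mono {f : X ⟶ Y} (g : Y ⟶ Z) [Mono g.map]
    (h : IsTrivialMor (isTrivial C) (f ≫ g)) : IsTrivialMor (isTrivial C) f := by
  rw [isTrivialMor_iff, comp_map] at h
  rw [isTrivialMor_iff, ← cancel_mono g.map]
  simpa using h

lemma isTrivialMor_of_isInitial (h : IsInitial X) (f : X ⟶ Y) : IsTrivialMor (isTrivial C) f :=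
  ⟨discrete (⊥_ C), h.to _, discreteHom (initial.to _), isTrivial_discrete _, h.hom_ext _ _⟩

end Decompositions

/-! ### Partial morphisms as total morphisms into a coproduct with the point -/

section Maybe

variable {C : Type u} [Category.{v} C] [HasFiniteLimits C] [FinitaryExtensive C]
  {X Y Z W : InternalPreorder C}

variable (C) in
/-- The terminal preorder. -/
noncomputable abbrev point : InternalPreorder C := discrete (⊤_ C)

/-- The morphism to the terminal preorder. -/
noncomputable def toPoint (X : InternalPreorder C) : X ⟶ point C :=
  Hom.mk (Y := point C) (terminal.from X.carrier) (terminal.from X.rel)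
    (terminal.hom_ext _ _) (terminal.hom_ext _ _)

lemma toPoint_unique (f g : X ⟶ point C) : f = g :=
  hom_ext (terminal.hom_ext (C := C) _ _)

/-- The coproduct of `Y` with the terminal preorder. Morphisms into it are the same as partial
morphisms into `Y` with complemented domain. -/
noncomputable def maybe (Y : InternalPreorder C) : InternalPreorder C := sum Y (point C)

/-- The inclusion of `Y` into `maybe Y`. -/
noncomputable def just (Y : InternalPreorder C) : Y ⟶ maybe Y := sumInl _ _

/-- The added point of `maybe Y`. -/
noncomputable def nothing (Y : InternalPreorder C) : point C ⟶ maybe Y := sumInr _ _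

lemma isDecomp_maybe (Y : InternalPreorder C) : IsDecomp (just Y) (nothing Y) := isDecomp_sum _ _

instance (Y : InternalPreorder C) : Mono (just Y).map := (coprod_mono (isDecomp_maybe Y).1).1

instance (Y : InternalPreorder C) : Mono (just Y) := mono_of_map _ inferInstance

lemma isTrivialMor_comp_nothing (f : X ⟶ point C) :
    IsTrivialMor (isTrivial C) (f ≫ nothing Y) :=
  ⟨point C, f, nothing Y, isTrivial_discrete _, rfl⟩

end Maybe

end InternalPreorder

section PartialMorphisms

open InternalPreorder

variable {C : Type u} [Category.{v} C]

lemma PartialMap.toHom_eq_iff [HasPullbacks C] [FinitaryExtensive C] {X Y : InternalPreorder C}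
    {s t : PartialMap X Y} : s.toHom = t.toHom ↔ s ≈ t := Quotient.eq

lemma PartialMap.toHom_comp [HasPullbacks C] [FinitaryExtensive C] {X Y Z : InternalPreorder C}
    (s : PartialMap X Y) (t : PartialMap Y Z) :
    s.toHom ≫ t.toHom = (PartialMap.comp s t).toHom := rfl

lemma PartialMap.exists_toHom_eq [HasPullbacks C] [FinitaryExtensive C]
    {X Y : InternalPreorder C} (F : PaPreOrd.mk X ⟶ PaPreOrd.mk Y) :
    ∃ s : PartialMap X Y, s.toHom = F := Quotient.exists_rep F

namespace PaPreOrd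

variable [HasFiniteLimits C] [FinitaryExtensive C] {X Y Z W : InternalPreorder C}

/-- A total morphism as a partial morphism. -/
noncomputable def tot (f : X ⟶ Y) : PaPreOrd.mk X ⟶ PaPreOrd.mk Y := (paInclusion C).map f

lemma tot_eq_toHom (f : X ⟶ Y) : tot f = (PartialMap.ofHom f).toHom := rfl

lemma tot_id (X : InternalPreorder C) : tot (𝟙 X) = 𝟙 (PaPreOrd.mk X) := rfl

lemma tot_comp (f : X ⟶ Y) (g : Y ⟶ Z) : tot (f ≫ g) = tot f ≫ tot g :=
  (paInclusion C).map_comp f g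

/-- A representative of the partial inverse of `just Y`. -/
noncomputable abbrev unjustRep (Y : InternalPreorder C) : PartialMap (maybe Y) Y :=
  ⟨Y, just Y, 𝟙 Y, _, _, (isDecomp_maybe Y).isComplement⟩

/-- The partial inverse of `just Y`. -/
noncomputable def unjust (Y : InternalPreorder C) : PaPreOrd.mk (maybe Y) ⟶ PaPreOrd.mk Y :=
  (unjustRep Y).toHom

/-- The partial morphism corresponding to a morphism into `maybe Y`. -/
noncomputable def ofMaybe (h : X ⟶ maybe Y) : PaPreOrd.mk X ⟶ PaPreOrd.mk Y := tot h ≫ unjust Y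

lemma ofMaybe_eq_toHom (h : X ⟶ maybe Y) :
    ofMaybe h = (PartialMap.comp (PartialMap.ofHom h) (unjustRep Y)).toHom := rfl

lemma tot_comp_ofMaybe (f : X ⟶ Y) (h : Y ⟶ maybe Z) : tot f ≫ ofMaybe h = ofMaybe (f ≫ h) := by
  rw [ofMaybe, ofMaybe, tot_comp, Category.assoc]

/-- A partial morphism with complemented domain is extended by the added point outside its domain
of definition. -/
lemma exists_ofMaybe_eq (F : PaPreOrd.mk X ⟶ PaPreOrd.mk Y) :
    ∃ h : X ⟶ maybe Y, ofMaybe h = F := by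
  obtain ⟨s, rfl⟩ := PartialMap.exists_toHom_eq F
  obtain ⟨D, β, hs⟩ := s.complemented
  rw [isComplement_iff] at hs
  obtain ⟨h, h₁, h₂⟩ := hs.exists_desc (s.map ≫ just Y) (toPoint D ≫ nothing Y)
  refine ⟨h, ?_⟩
  have hp := pb_isPullback h (just Y)
  obtain ⟨b, b₁, b₂⟩ := hp.exists_lift s.ι s.map h₁
  obtain ⟨a, ha⟩ := hs.symm.exists_lift (pbFst h (just Y)) (fun T x y e =>
    (isDecomp_maybe Y).isInitial (x ≫ pbSnd h (just Y)) (y ≫ toPoint D) (by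
      rw [Category.assoc, ← hp.w, reassoc_of% e, h₂, Category.assoc]))
  have ha' : a ≫ s.map = pbSnd h (just Y) := by
    rw [← cancel_mono (just Y), Category.assoc, ← h₁, reassoc_of% ha, hp.w]
  rw [ofMaybe_eq_toHom, PartialMap.toHom_eq_iff]
  exact PartialMap.rel_of (s := PartialMap.comp (PartialMap.ofHom h) (unjustRep Y)) (t := s) a b
    (ha.trans (Category.comp_id _).symm) ((congrArg (b ≫ ·) (Category.comp_id _)).trans b₁)
    (ha'.trans (Category.comp_id _).symm)

/-- A morphism into `maybe Y` is determined by its restriction to the inverse image of `Y`. -/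
lemma ofMaybe_injective {h k : X ⟶ maybe Y} (e : ofMaybe h = ofMaybe k) : h = k := by
  rw [ofMaybe_eq_toHom, ofMaybe_eq_toHom, PartialMap.toHom_eq_iff] at e
  obtain ⟨(φ : pb h (just Y) ≅ pb k (just Y)),
    (h₁ : φ.hom ≫ pbFst k (just Y) ≫ 𝟙 X = pbFst h (just Y) ≫ 𝟙 X),
    (h₂ : φ.hom ≫ pbSnd k (just Y) ≫ 𝟙 Y = pbSnd h (just Y) ≫ 𝟙 Y)⟩ := e
  simp only [Category.comp_id] at h₁ h₂
  refine ((isDecomp_maybe Y).pbFst h).hom_ext ?_ ?_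
  · rw [(pb_isPullback h (just Y)).w, ← h₂, Category.assoc, ← (pb_isPullback k (just Y)).w,
      reassoc_of% h₁]
  · obtain ⟨l, hl⟩ := ((isDecomp_maybe Y).pbFst k).exists_lift (pbFst h (nothing Y))
      (fun T x y e => ((isDecomp_maybe Y).pbFst h).isInitial (y ≫ φ.inv) x (by
        rw [e, ← h₁, Category.assoc, φ.inv_hom_id_assoc]))
    rw [(pb_isPullback h (nothing Y)).w, ← hl, Category.assoc, (pb_isPullback k (nothing Y)).w,
      ← Category.assoc, toPoint_unique (l ≫ pbSnd k (nothing Y)) (pbSnd h (nothing Y))]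

lemma ofMaybe_just (X : InternalPreorder C) : ofMaybe (just X) = 𝟙 (PaPreOrd.mk X) := by
  have hp := pb_isPullback (just X) (just X)
  obtain ⟨b, b₁, b₂⟩ := hp.exists_lift (𝟙 X) (𝟙 X) rfl
  rw [ofMaybe_eq_toHom, ← tot_id, tot_eq_toHom, PartialMap.toHom_eq_iff]
  exact PartialMap.rel_of (s := PartialMap.comp (PartialMap.ofHom (just X)) (unjustRep X))
    (t := PartialMap.ofHom (𝟙 X)) (pbFst (just X) (just X)) b rfl
    ((congrArg (b ≫ ·) (Category.comp_id _)).trans b₁)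
    (congrArg (· ≫ 𝟙 X) ((cancel_mono (just X)).1 hp.w))

lemma tot_just_comp_unjust (X : InternalPreorder C) :
    tot (just X) ≫ unjust X = 𝟙 (PaPreOrd.mk X) := ofMaybe_just X

lemma tot_eq_ofMaybe (f : X ⟶ Y) : tot f = ofMaybe (f ≫ just Y) := by
  rw [← tot_comp_ofMaybe, ofMaybe_just, Category.comp_id]

/-- A coproduct decomposition remains jointly epimorphic for partial morphisms. -/
lemma hom_ext_of_isDecomp {α : X ⟶ Z} {β : Y ⟶ Z} (h : IsDecomp α β)
    {F G : PaPreOrd.mk Z ⟶ PaPreOrd.mk W} (h₁ : tot α ≫ F = tot α ≫ G)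
    (h₂ : tot β ≫ F = tot β ≫ G) : F = G := by
  obtain ⟨f, rfl⟩ := exists_ofMaybe_eq F
  obtain ⟨g, rfl⟩ := exists_ofMaybe_eq G
  rw [tot_comp_ofMaybe, tot_comp_ofMaybe] at h₁ h₂
  rw [h.hom_ext (ofMaybe_injective h₁) (ofMaybe_injective h₂)]

/-- The nowhere defined partial morphism. -/
noncomputable def null (X Y : InternalPreorder C) : PaPreOrd.mk X ⟶ PaPreOrd.mk Y :=
  ofMaybe (toPoint X ≫ nothing Y)

lemma toHom_eq_null (s : PartialMap X Y) (hs : IsInitial s.dom) : s.toHom = null X Y :=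
  PartialMap.toHom_eq_iff.2 (PartialMap.rel_of_initial _ _ ⟨hs⟩
    ((isDecomp_maybe Y).isInitial (pbSnd (toPoint X ≫ nothing Y) (just Y))
      (pbFst (toPoint X ≫ nothing Y) (just Y) ≫ toPoint X)
      ((pb_isPullback _ _).w.symm.trans (Category.assoc _ _ _).symm)))

lemma null_comp (F : PaPreOrd.mk Y ⟶ PaPreOrd.mk Z) : null X Y ≫ F = null X Z := by
  obtain ⟨s, rfl⟩ := PartialMap.exists_toHom_eq F
  let Z₀ : PartialMap X Y := ⟨discrete (⊥_ C), discreteHom (initial.to _),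
    discreteHom (initial.to _), isComplementedSub_initial X⟩
  obtain ⟨h₀⟩ := isInitial_of_hom (𝟙 (discrete (⊥_ C)))
  rw [← toHom_eq_null Z₀ h₀, PartialMap.toHom_comp]
  obtain ⟨h₁⟩ := isInitial_of_hom (pbFst Z₀.map s.ι)
  exact toHom_eq_null _ h₁

/-- Every morphism into `maybe Y` extends to `maybe X`, preserving the added point. -/
lemma exists_bind (k : X ⟶ maybe Y) :
    ∃ b : maybe X ⟶ maybe Y, just X ≫ b = k ∧ nothing X ≫ b = nothing Y :=
  (isDecomp_maybe X).exists_desc k (nothing Y)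

lemma null_point (Y : InternalPreorder C) : ofMaybe (nothing Y) = null (point C) Y := by
  rw [null, toPoint_unique (toPoint (point C)) (𝟙 _), Category.id_comp]

lemma tot_nothing_comp_unjust (Y : InternalPreorder C) :
    tot (nothing Y) ≫ unjust Y = null (point C) Y := null_point Y

lemma unjust_comp_ofMaybe {k : X ⟶ maybe Y} {b : maybe X ⟶ maybe Y} (h₁ : just X ≫ b = k)
    (h₂ : nothing X ≫ b = nothing Y) : unjust X ≫ ofMaybe k = ofMaybe b := by
  refine hom_ext_of_isDecomp (isDecomp_maybe X) ?_ ?_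
  · rw [← Category.assoc, tot_just_comp_unjust, Category.id_comp, tot_comp_ofMaybe, h₁]
  · rw [← Category.assoc, tot_nothing_comp_unjust, null_comp, tot_comp_ofMaybe, h₂, null_point]

/-- Composition of partial morphisms in terms of morphisms into `maybe`. -/
lemma ofMaybe_comp_ofMaybe (h : X ⟶ maybe Y) {k : Y ⟶ maybe Z} {b : maybe Y ⟶ maybe Z}
    (h₁ : just Y ≫ b = k) (h₂ : nothing Y ≫ b = nothing Z) :
    ofMaybe h ≫ ofMaybe k = ofMaybe (h ≫ b) := by
  rw [← tot_comp_ofMaybe, ← unjust_comp_ofMaybe h₁ h₂, ← Category.assoc, ← ofMaybe]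

/-- A partial morphism is trivial if it is trivial on its domain. -/
def IsTrivialPartial (F : PaPreOrd.mk X ⟶ PaPreOrd.mk Y) : Prop :=
  ∃ s : PartialMap X Y, s.toHom = F ∧ IsTrivialMor (isTrivial C) s.map

lemma isTrivialPartial_toHom_iff (s : PartialMap X Y) :
    IsTrivialPartial s.toHom ↔ IsTrivialMor (isTrivial C) s.map := by
  refine ⟨?_, fun h => ⟨s, rfl, h⟩⟩
  rintro ⟨t, ht, h⟩
  obtain ⟨e, -, h₂⟩ := PartialMap.toHom_eq_iff.1 ht.symm
  rw [← h₂]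
  exact h.comp_left _

lemma isTrivialPartial_ofMaybe_iff (h : X ⟶ maybe Y) :
    IsTrivialPartial (ofMaybe h) ↔ IsTrivialMor (isTrivial C) h := by
  rw [ofMaybe_eq_toHom, isTrivialPartial_toHom_iff]
  change IsTrivialMor (isTrivial C) (pbSnd h (just Y) ≫ 𝟙 Y) ↔ _
  rw [Category.comp_id]
  refine ⟨fun hh => ((isDecomp_maybe Y).pbFst h).isTrivialMor ?_ ?_, fun hh => ?_⟩
  · rw [(pb_isPullback h (just Y)).w]
    exact hh.comp_right _
  · rw [(pb_isPullback h (nothing Y)).w]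
    exact isTrivialMor_comp_nothing _
  · refine isTrivialMor_of_comp_mono (just Y) ?_
    rw [← (pb_isPullback h (just Y)).w]
    exact hh.comp_left _

lemma isTrivialPartial_null (X Y : InternalPreorder C) : IsTrivialPartial (null X Y) :=
  (isTrivialPartial_ofMaybe_iff _).2 (isTrivialMor_comp_nothing _)

lemma IsTrivialPartial.comp_right {F : PaPreOrd.mk X ⟶ PaPreOrd.mk Y} (hF : IsTrivialPartial F)
    (G : PaPreOrd.mk Y ⟶ PaPreOrd.mk Z) : IsTrivialPartial (F ≫ G) := by
  obtain ⟨h, rfl⟩ := exists_ofMaybe_eq F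
  obtain ⟨k, rfl⟩ := exists_ofMaybe_eq G
  obtain ⟨b, h₁, h₂⟩ := exists_bind k
  rw [isTrivialPartial_ofMaybe_iff] at hF
  rw [ofMaybe_comp_ofMaybe h h₁ h₂, isTrivialPartial_ofMaybe_iff]
  exact hF.comp_right _

lemma IsTrivialPartial.comp_left {G : PaPreOrd.mk Y ⟶ PaPreOrd.mk Z} (hG : IsTrivialPartial G)
    (F : PaPreOrd.mk X ⟶ PaPreOrd.mk Y) : IsTrivialPartial (F ≫ G) := by
  obtain ⟨h, rfl⟩ := exists_ofMaybe_eq F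
  obtain ⟨k, rfl⟩ := exists_ofMaybe_eq G
  obtain ⟨b, h₁, h₂⟩ := exists_bind k
  rw [isTrivialPartial_ofMaybe_iff] at hG
  rw [ofMaybe_comp_ofMaybe h h₁ h₂, isTrivialPartial_ofMaybe_iff]
  refine IsTrivialMor.comp_left ((isDecomp_maybe Y).isTrivialMor (by rwa [h₁]) ?_) h
  rw [h₂, ← Category.id_comp (nothing Z)]
  exact isTrivialMor_comp_nothing _

lemma isTrivialPartial_of_isDecomp {α : X ⟶ Z} {β : Y ⟶ Z} (h : IsDecomp α β)
    {F : PaPreOrd.mk Z ⟶ PaPreOrd.mk W} (h₁ : IsTrivialPartial (tot α ≫ F))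
    (h₂ : IsTrivialPartial (tot β ≫ F)) : IsTrivialPartial F := by
  obtain ⟨f, rfl⟩ := exists_ofMaybe_eq F
  rw [tot_comp_ofMaybe, isTrivialPartial_ofMaybe_iff] at h₁ h₂
  exact (isTrivialPartial_ofMaybe_iff f).2 (h.isTrivialMor h₁ h₂)

end PaPreOrd

end PartialMorphisms

/-! ### The stable congruence -/

section StableCategory

open InternalPreorder PaPreOrd

variable {C : Type u} [Category.{v} C] [HasFiniteLimits C] [FinitaryExtensive C]
  {X Y Z W : InternalPreorder C}

namespace PaPreOrd

/-- Two partial morphisms are stably equal if they agree on one summand of a decomposition of the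
domain and are both trivial on the other one. -/
def StableEq (F G : PaPreOrd.mk X ⟶ PaPreOrd.mk Y) : Prop :=
  ∃ (E N : InternalPreorder C) (e : E ⟶ X) (n : N ⟶ X), IsDecomp e n ∧ tot e ≫ F = tot e ≫ G ∧
    IsTrivialPartial (tot n ≫ F) ∧ IsTrivialPartial (tot n ≫ G)

lemma StableEq.refl (F : PaPreOrd.mk X ⟶ PaPreOrd.mk Y) : StableEq F F := by
  obtain ⟨h⟩ := isInitial_of_hom (𝟙 (discrete (⊥_ C)))
  have hn : IsTrivialPartial (tot (h.to X) ≫ F) := by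
    obtain ⟨f, rfl⟩ := exists_ofMaybe_eq F
    rw [tot_comp_ofMaybe, isTrivialPartial_ofMaybe_iff]
    exact isTrivialMor_of_isInitial h _
  exact ⟨X, _, 𝟙 X, h.to X, isDecomp_id_of_isInitial h _, rfl, hn, hn⟩

lemma StableEq.symm {F G : PaPreOrd.mk X ⟶ PaPreOrd.mk Y} (h : StableEq F G) : StableEq G F :=
  let ⟨E, N, e, n, hd, he, h₁, h₂⟩ := h
  ⟨E, N, e, n, hd, he.symm, h₂, h₁⟩

lemma StableEq.trans {F G H : PaPreOrd.mk X ⟶ PaPreOrd.mk Y} (h : StableEq F G)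
    (h' : StableEq G H) : StableEq F H := by
  obtain ⟨E, N, e, n, hd, he, h₁, h₂⟩ := h
  obtain ⟨E', N', e', n', hd', he', h₁', h₂'⟩ := h'
  have eq : ∀ {T : InternalPreorder C} {a : T ⟶ E} {b : T ⟶ X}, a ≫ e = b →
      tot b ≫ F = tot b ≫ G := by
    rintro T a b rfl
    rw [tot_comp, Category.assoc, he, Category.assoc]
  have eq' : ∀ {T : InternalPreorder C} {a : T ⟶ E'} {b : T ⟶ X}, a ≫ e' = b →
      tot b ≫ G = tot b ≫ H := by
    rintro T a b rfl
    rw [tot_comp, Category.assoc, he', Category.assoc]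
  have triv : ∀ {T S : InternalPreorder C} {a : T ⟶ S} {c : S ⟶ X} {b : T ⟶ X}
      {K : PaPreOrd.mk X ⟶ PaPreOrd.mk Y}, IsTrivialPartial (tot c ≫ K) → a ≫ c = b →
      IsTrivialPartial (tot b ≫ K) := by
    rintro T S a c b K hc rfl
    rw [tot_comp, Category.assoc]
    exact hc.comp_left _
  -- The new decomposition is `E ∩ E'` and `(E ∩ N') ∪ N`.
  obtain ⟨d, hdd, d₁, d₂⟩ := (hd'.pbFst e).refine hd
  refine ⟨_, _, _, d, hdd, (eq rfl).trans (eq' (pb_isPullback e e').w.symm),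
    isTrivialPartial_of_isDecomp (isDecomp_sum _ _) ?_ ?_,
    isTrivialPartial_of_isDecomp (isDecomp_sum _ _) ?_ ?_⟩
  · rw [← Category.assoc, ← tot_comp, d₁, eq rfl]
    exact triv h₁' (pb_isPullback e n').w.symm
  · rw [← Category.assoc, ← tot_comp, d₂]
    exact h₁
  · rw [← Category.assoc, ← tot_comp, d₁]
    exact triv h₂' (pb_isPullback e n').w.symm
  · rw [← Category.assoc, ← tot_comp, d₂]
    refine isTrivialPartial_of_isDecomp (hd'.pbFst n) ?_ ?_ <;> rw [← Category.assoc, ← tot_comp]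
    · rw [← eq' (pb_isPullback n e').w.symm]
      exact triv h₂ rfl
    · exact triv h₂' (pb_isPullback n n').w.symm

lemma StableEq.comp_right {F G : PaPreOrd.mk X ⟶ PaPreOrd.mk Y} (h : StableEq F G)
    (H : PaPreOrd.mk Y ⟶ PaPreOrd.mk Z) : StableEq (F ≫ H) (G ≫ H) := by
  obtain ⟨E, N, e, n, hd, he, h₁, h₂⟩ := h
  exact ⟨E, N, e, n, hd, by rw [← Category.assoc, he, Category.assoc],
    by rw [← Category.assoc]; exact h₁.comp_right H,
    by rw [← Category.assoc]; exact h₂.comp_right H⟩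

lemma StableEq.tot_comp {F G : PaPreOrd.mk Y ⟶ PaPreOrd.mk Z} (h : StableEq F G) (f : X ⟶ Y) :
    StableEq (tot f ≫ F) (tot f ≫ G) := by
  obtain ⟨E, N, e, n, hd, he, h₁, h₂⟩ := h
  refine ⟨_, _, _, _, hd.pbFst f, ?_, ?_, ?_⟩ <;>
    simp only [← Category.assoc, ← PaPreOrd.tot_comp, (pb_isPullback f _).w] <;>
    simp only [PaPreOrd.tot_comp, Category.assoc]
  · rw [he]
  · exact h₁.comp_left _
  · exact h₂.comp_left _

lemma StableEq.unjust_comp {F G : PaPreOrd.mk Y ⟶ PaPreOrd.mk Z} (h : StableEq F G) :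
    StableEq (unjust Y ≫ F) (unjust Y ≫ G) := by
  obtain ⟨E, N, e, n, hd, he, h₁, h₂⟩ := h
  obtain ⟨d, hdd, d₁, d₂⟩ := hd.refine (isDecomp_maybe Y)
  have hj : ∀ H : PaPreOrd.mk Y ⟶ PaPreOrd.mk Z, IsTrivialPartial (tot n ≫ H) →
      IsTrivialPartial (tot d ≫ unjust Y ≫ H) := fun H hH => by
    refine isTrivialPartial_of_isDecomp (isDecomp_sum _ _) ?_ ?_ <;>
      rw [← Category.assoc, ← PaPreOrd.tot_comp]
    · rw [d₁, PaPreOrd.tot_comp, Category.assoc, ← Category.assoc (tot (just Y)),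
        tot_just_comp_unjust, Category.id_comp]
      exact hH
    · rw [d₂, ← Category.assoc, tot_nothing_comp_unjust, null_comp]
      exact isTrivialPartial_null _ _
  refine ⟨_, _, _, d, hdd, ?_, hj F h₁, hj G h₂⟩
  rw [PaPreOrd.tot_comp, Category.assoc, Category.assoc, ← Category.assoc (tot (just Y)),
    ← Category.assoc (tot (just Y)), tot_just_comp_unjust, Category.id_comp, Category.id_comp, he]

/-- Stable equality is compatible with composition on the left: it suffices to treat total morphisms
and the partial inverses of `just`. -/
lemma StableEq.comp_left {F G : PaPreOrd.mk Y ⟶ PaPreOrd.mk Z} (h : StableEq F G)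
    (H : PaPreOrd.mk X ⟶ PaPreOrd.mk Y) : StableEq (H ≫ F) (H ≫ G) := by
  obtain ⟨k, rfl⟩ := exists_ofMaybe_eq H
  rw [ofMaybe, Category.assoc, Category.assoc]
  exact h.unjust_comp.tot_comp k

lemma StableEq.of_isDecomp {α : X ⟶ Z} {β : Y ⟶ Z} (h : IsDecomp α β)
    {F G : PaPreOrd.mk Z ⟶ PaPreOrd.mk W} (h₁ : StableEq (tot α ≫ F) (tot α ≫ G))
    (h₂ : StableEq (tot β ≫ F) (tot β ≫ G)) : StableEq F G := by
  obtain ⟨E, N, e, n, hd, he, t₁, t₂⟩ := h₁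
  obtain ⟨E', N', e', n', hd', he', t₁', t₂'⟩ := h₂
  obtain ⟨x, y, hxy, x₁, x₂, y₁, y₂⟩ := h.interchange hd hd'
  refine ⟨_, _, x, y, hxy, hom_ext_of_isDecomp (isDecomp_sum _ _) ?_ ?_,
    isTrivialPartial_of_isDecomp (isDecomp_sum _ _) ?_ ?_,
    isTrivialPartial_of_isDecomp (isDecomp_sum _ _) ?_ ?_⟩ <;>
    simp only [← Category.assoc, ← PaPreOrd.tot_comp, x₁, x₂, y₁, y₂] <;>
    simp only [PaPreOrd.tot_comp, Category.assoc] <;> assumption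

lemma tot_ι_comp_toHom (s : PartialMap X Y) : tot s.ι ≫ s.toHom = tot s.map := by
  have := s.mono_ι
  have hp := pb_isPullback s.ι s.ι
  obtain ⟨b, b₁, b₂⟩ := hp.exists_lift (𝟙 _) (𝟙 _) rfl
  rw [tot_eq_toHom, tot_eq_toHom, PartialMap.toHom_comp, PartialMap.toHom_eq_iff]
  exact PartialMap.rel_of (s := PartialMap.comp (PartialMap.ofHom s.ι) s)
    (t := PartialMap.ofHom s.map) (pbFst s.ι s.ι) b rfl
    ((congrArg (b ≫ ·) (Category.comp_id _)).trans b₁)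
    (congrArg (· ≫ s.map) ((cancel_mono s.ι).1 hp.w))

lemma isTrivialPartial_tot_iff (f : X ⟶ Y) :
    IsTrivialPartial (tot f) ↔ IsTrivialMor (isTrivial C) f :=
  isTrivialPartial_toHom_iff (PartialMap.ofHom f)

lemma tot_comp_toHom_eq_null (s : PartialMap X Y) {β : Z ⟶ X} (h : IsDecomp s.ι β) :
    tot β ≫ s.toHom = null Z Y := by
  rw [tot_eq_toHom, PartialMap.toHom_comp]
  obtain ⟨hI⟩ := h.isInitial (pbSnd β s.ι) (pbFst β s.ι) (pb_isPullback β s.ι).w.symm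
  exact toHom_eq_null _ hI

/-- If a partial morphism is trivial on a summand of its domain of definition, then it is trivial
on the complement of the other summand. -/
lemma isTrivialPartial_tot_comp_toHom (s : PartialMap X Y) {A B N : InternalPreorder C}
    {i : A ⟶ s.dom} {i' : B ⟶ s.dom} {n : N ⟶ X} (hi : IsDecomp i i')
    (hn : IsDecomp (i ≫ s.ι) n) (h : IsTrivialMor (isTrivial C) (i' ≫ s.map)) :
    IsTrivialPartial (tot n ≫ s.toHom) := by
  obtain ⟨D, β, hs⟩ := s.complemented
  rw [isComplement_iff] at hs
  obtain ⟨d, hd, d₁, d₂⟩ := hi.refine hs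
  obtain ⟨l, rfl⟩ := hd.exists_lift_of_isDecomp hn
  rw [tot_comp, Category.assoc]
  refine IsTrivialPartial.comp_left (isTrivialPartial_of_isDecomp (isDecomp_sum _ _) ?_ ?_) _ <;>
    rw [← Category.assoc, ← tot_comp]
  · rw [d₁, tot_comp, Category.assoc, tot_ι_comp_toHom, ← tot_comp, isTrivialPartial_tot_iff]
    exact h
  · rw [d₂, tot_comp_toHom_eq_null s hs]
    exact isTrivialPartial_null _ _

/-- The congruence defining the stable category, whose decompositions are those of the domains of
definition, in terms of decompositions of the whole domain. -/
lemma stableRel_iff (F G : PaPreOrd.mk X ⟶ PaPreOrd.mk Y) : stableRel C F G ↔ StableEq F G := by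
  constructor
  · rintro ⟨s, t, rfl, rfl, A₀, A₁, A₂, i, i', j, j', hi, hj, e, ⟨N, n, hn⟩, e', h₁, h₂⟩
    rw [isComplement_iff] at hi hj hn
    refine ⟨A₀, N, i ≫ s.ι, n, hn, ?_, isTrivialPartial_tot_comp_toHom s hi hn h₁,
      isTrivialPartial_tot_comp_toHom t hj (by rw [← e]; exact hn) h₂⟩
    calc tot (i ≫ s.ι) ≫ s.toHom = tot (i ≫ s.map) := by
          rw [tot_comp, Category.assoc, tot_ι_comp_toHom, tot_comp]
      _ = tot (i ≫ s.ι) ≫ t.toHom := by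
          rw [e, e', tot_comp, tot_comp, Category.assoc, tot_ι_comp_toHom]
  · rintro ⟨E, N, e, n, hd, he, h₁, h₂⟩
    obtain ⟨s, rfl⟩ := PartialMap.exists_toHom_eq F
    obtain ⟨t, rfl⟩ := PartialMap.exists_toHom_eq G
    rw [tot_eq_toHom, PartialMap.toHom_comp, PartialMap.toHom_comp, PartialMap.toHom_eq_iff] at he
    rw [tot_eq_toHom, PartialMap.toHom_comp, isTrivialPartial_toHom_iff] at h₁ h₂
    obtain ⟨(φ : pb e s.ι ≅ pb e t.ι), (φ₁ : φ.hom ≫ pbFst e t.ι ≫ 𝟙 E = pbFst e s.ι ≫ 𝟙 E),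
      (φ₂ : φ.hom ≫ pbSnd e t.ι ≫ t.map = pbSnd e s.ι ≫ s.map)⟩ := he
    rw [Category.comp_id, Category.comp_id] at φ₁
    refine ⟨s, t, rfl, rfl, pb e s.ι, pb n s.ι, pb n t.ι, pbSnd e s.ι, pbSnd n s.ι,
      φ.hom ≫ pbSnd e t.ι, pbSnd n t.ι, (hd.pbSnd s.ι).isComplement,
      ((hd.pbSnd t.ι).iso_left φ).isComplement, ?_, ?_, φ₂.symm.trans (Category.assoc _ _ _).symm, h₁, h₂⟩
    · rw [Category.assoc, ← (pb_isPullback e t.ι).w, ← (pb_isPullback e s.ι).w, reassoc_of% φ₁]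
    · exact isComplementedSub_comp ⟨_, _, (hd.pbSnd s.ι).isComplement⟩ s.complemented

end PaPreOrd

instance : Congruence (stableRel C) where
  equivalence {X Y} :=
    { refl := fun F => (stableRel_iff F F).2 (StableEq.refl F)
      symm := fun {F G} h => (stableRel_iff G F).2 ((stableRel_iff F G).1 h).symm
      trans := fun {F G H} h h' =>
        (stableRel_iff F H).2 (((stableRel_iff F G).1 h).trans ((stableRel_iff G H).1 h')) }
  comp_left F _ _ h := (stableRel_iff _ _).2 (((stableRel_iff _ _).1 h).comp_left F)
  comp_right G h := (stableRel_iff _ _).2 (((stableRel_iff _ _).1 h).comp_right G)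

end StableCategory

/-! ### Preservation of finite coproducts -/

section FiniteCoproducts

variable {A : Type u₁} [Category.{v₁} A] {B : Type u₂} [Category.{v₂} B]

lemma hasFiniteCoproducts_of_cocones {I : A} (hI : IsInitial I)
    (h : ∀ X Y : A, ∃ (Z : A) (i : X ⟶ Z) (j : Y ⟶ Z),
      Nonempty (IsColimit (BinaryCofan.mk i j))) : HasFiniteCoproducts A := by
  have := hI.hasInitial
  have : ∀ {X Y : A}, HasColimit (pair X Y) := fun {X Y} =>
    let ⟨_, _, _, ⟨hc⟩⟩ := h X Y
    ⟨⟨_, hc⟩⟩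
  have := hasBinaryCoproducts_of_hasColimit_pair A
  exact hasFiniteCoproducts_of_has_binary_and_initial

/-- A functor preserves finite coproducts if it preserves one initial object, and one coproduct of
each pair of objects. -/
lemma preservesFiniteCoproducts_of_cocones (F : A ⥤ B) {I : A} (hI : IsInitial I)
    (hFI : IsInitial (F.obj I))
    (h : ∀ X Y : A, ∃ (Z : A) (i : X ⟶ Z) (j : Y ⟶ Z), Nonempty (IsColimit (BinaryCofan.mk i j)) ∧
      Nonempty (IsColimit (BinaryCofan.mk (F.map i) (F.map j)))) :
    PreservesFiniteCoproducts F := by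
  have := hasFiniteCoproducts_of_cocones hI fun X Y =>
    let ⟨Z, i, j, hc, _⟩ := h X Y
    ⟨Z, i, j, hc⟩
  have : PreservesColimit (Functor.empty.{0} A) F :=
    preservesColimit_of_preserves_colimit_cocone hI
      ((isColimitMapCoconeEmptyCoconeEquiv F I).symm hFI)
  have := preservesColimitsOfShape_pempty_of_preservesInitial F
  have : PreservesColimitsOfShape (Discrete WalkingPair) F := ⟨fun {K} => by
    obtain ⟨_, i, j, ⟨hc⟩, ⟨hFc⟩⟩ := h (K.obj ⟨.left⟩) (K.obj ⟨.right⟩)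
    have := preservesColimit_of_preserves_colimit_cocone hc
      ((isColimitMapCoconeBinaryCofanEquiv F i j).symm hFc)
    exact preservesColimit_of_iso_diagram F (diagramIsoPair K).symm⟩
  exact ⟨fun n => PreservesFiniteCoproducts.of_preserves_binary_and_initial F (Fin n)⟩

end FiniteCoproducts

section StableTorsion

open InternalPreorder PaPreOrd

variable {C : Type u} [Category.{v} C] [HasFiniteLimits C] [FinitaryExtensive C]
  {X Y Z W : InternalPreorder C}

/-! ### Morphisms and coproducts of the stable category -/

/-- The stable class of a partial morphism. -/
noncomputable def stab (F : PaPreOrd.mk X ⟶ PaPreOrd.mk Y) :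
    (stabFunctor C).obj X ⟶ (stabFunctor C).obj Y :=
  (CategoryTheory.Quotient.functor (stableRel C)).map F

lemma exists_stabFunctor_obj_eq (X : Stab C) :
    ∃ Y : InternalPreorder C, (stabFunctor C).obj Y = X := ⟨X.as.as, rfl⟩

lemma stab_tot (f : X ⟶ Y) : stab (tot f) = (stabFunctor C).map f := rfl

lemma stab_id (X : InternalPreorder C) : stab (𝟙 (PaPreOrd.mk X)) = 𝟙 ((stabFunctor C).obj X) :=
  rfl

lemma stab_comp (F : PaPreOrd.mk X ⟶ PaPreOrd.mk Y) (G : PaPreOrd.mk Y ⟶ PaPreOrd.mk Z) :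
    stab (F ≫ G) = stab F ≫ stab G :=
  (CategoryTheory.Quotient.functor (stableRel C)).map_comp F G

lemma exists_stab_eq (f : (stabFunctor C).obj X ⟶ (stabFunctor C).obj Y) :
    ∃ F : PaPreOrd.mk X ⟶ PaPreOrd.mk Y, stab F = f :=
  (CategoryTheory.Quotient.functor (stableRel C)).map_surjective (X := PaPreOrd.mk X)
    (Y := PaPreOrd.mk Y) f

lemma stab_eq_iff (F G : PaPreOrd.mk X ⟶ PaPreOrd.mk Y) : stab F = stab G ↔ StableEq F G :=
  (Quotient.functor_map_eq_iff (stableRel C) F G).trans (stableRel_iff F G)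

lemma stab_null (X Y : InternalPreorder C) : stab (null X Y) = 0 := by
  rw [← null_comp (null (discrete (⊥_ C)) Y), stab_comp, isZero_stab.eq_zero_of_tgt (stab _),
    zero_comp]

/-- The zero morphisms of the stable category are the classes of trivial partial morphisms. -/
lemma stab_eq_zero_iff (F : PaPreOrd.mk X ⟶ PaPreOrd.mk Y) :
    stab F = 0 ↔ IsTrivialPartial F := by
  rw [← stab_null, stab_eq_iff]
  constructor
  · rintro ⟨E, N, e, n, hd, he, h₁, -⟩
    exact isTrivialPartial_of_isDecomp hd
      (by rw [he]; exact (isTrivialPartial_null _ _).comp_left _) h₁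
  · intro h
    obtain ⟨hI⟩ := isInitial_of_hom (𝟙 (discrete (⊥_ C)))
    refine ⟨_, X, hI.to X, 𝟙 X, (isDecomp_id_of_isInitial hI _).symm, ?_, h.comp_left _,
      (isTrivialPartial_null _ _).comp_left _⟩
    obtain ⟨f, rfl⟩ := exists_ofMaybe_eq F
    rw [null, tot_comp_ofMaybe, tot_comp_ofMaybe]
    exact congrArg ofMaybe (hI.hom_ext _ _)

lemma stabFunctor_map_eq_zero_iff (f : X ⟶ Y) :
    (stabFunctor C).map f = 0 ↔ IsTrivialMor (isTrivial C) f := by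
  rw [← stab_tot, stab_eq_zero_iff, isTrivialPartial_tot_iff]

lemma isColimit_stabFunctor_map {α : X ⟶ Z} {β : Y ⟶ Z} (h : IsDecomp α β) :
    Nonempty (IsColimit (BinaryCofan.mk ((stabFunctor C).map α) ((stabFunctor C).map β))) := by
  have hd : ∀ ⦃W : Stab C⦄ (f : (stabFunctor C).obj X ⟶ W) (g : (stabFunctor C).obj Y ⟶ W),
      ∃ d : (stabFunctor C).obj Z ⟶ W,
        (stabFunctor C).map α ≫ d = f ∧ (stabFunctor C).map β ≫ d = g := by
    intro W f g
    obtain ⟨W, rfl⟩ := exists_stabFunctor_obj_eq W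
    obtain ⟨F, rfl⟩ := exists_stab_eq f
    obtain ⟨G, rfl⟩ := exists_stab_eq g
    obtain ⟨p, rfl⟩ := exists_ofMaybe_eq F
    obtain ⟨q, rfl⟩ := exists_ofMaybe_eq G
    obtain ⟨d, d₁, d₂⟩ := h.exists_desc p q
    refine ⟨stab (ofMaybe d), ?_, ?_⟩
    · rw [← stab_tot, ← stab_comp, tot_comp_ofMaybe, d₁]
    · rw [← stab_tot, ← stab_comp, tot_comp_ofMaybe, d₂]
  have he : ∀ ⦃W : Stab C⦄ (f g : (stabFunctor C).obj Z ⟶ W),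
      (stabFunctor C).map α ≫ f = (stabFunctor C).map α ≫ g →
      (stabFunctor C).map β ≫ f = (stabFunctor C).map β ≫ g → f = g := by
    intro W f g h₁ h₂
    obtain ⟨W, rfl⟩ := exists_stabFunctor_obj_eq W
    obtain ⟨F, rfl⟩ := exists_stab_eq f
    obtain ⟨G, rfl⟩ := exists_stab_eq g
    rw [← stab_tot, ← stab_comp, ← stab_comp, stab_eq_iff] at h₁ h₂
    exact (stab_eq_iff F G).2 (StableEq.of_isDecomp h h₁ h₂)
  choose d d₁ d₂ using hd
  exact ⟨BinaryCofan.isColimitMk (fun s => d s.inl s.inr) (fun s => d₁ _ _) (fun s => d₂ _ _)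
    fun s m e₁ e₂ => he _ _ (e₁.trans (d₁ _ _).symm) (e₂.trans (d₂ _ _).symm)⟩

lemma isInitial_discrete_initial : Nonempty (IsInitial (discrete (⊥_ C))) :=
  isInitial_of_hom (𝟙 _)

lemma hasFiniteCoproducts_stab : HasFiniteCoproducts (Stab C) :=
  hasFiniteCoproducts_of_cocones isZero_stab.isInitial fun ⟨⟨X⟩⟩ ⟨⟨Y⟩⟩ =>
    ⟨_, (stabFunctor C).map (sumInl X Y), (stabFunctor C).map (sumInr X Y),
      isColimit_stabFunctor_map (isDecomp_sum X Y)⟩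

lemma preservesFiniteCoproducts_stabFunctor : PreservesFiniteCoproducts (stabFunctor C) :=
  preservesFiniteCoproducts_of_cocones _ isInitial_discrete_initial.some isZero_stab.isInitial
    fun X Y => ⟨_, sumInl X Y, sumInr X Y, (isDecomp_sum X Y).isColimit,
      isColimit_stabFunctor_map (isDecomp_sum X Y)⟩

/-! ### Exactness of the canonical functor -/

lemma toHom_comp_tot (s : PartialMap X Y) (f : Y ⟶ Z) :
    s.toHom ≫ tot f = (PartialMap.mk s.dom s.ι (s.map ≫ f) s.complemented).toHom := by
  have hp := pb_isPullback s.map (𝟙 Y)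
  obtain ⟨b, b₁, b₂⟩ := hp.exists_lift (𝟙 s.dom) s.map (by simp)
  rw [tot_eq_toHom, PartialMap.toHom_comp, PartialMap.toHom_eq_iff]
  refine PartialMap.rel_of (s := PartialMap.comp s (PartialMap.ofHom f))
    (t := ⟨s.dom, s.ι, s.map ≫ f, s.complemented⟩) (pbFst s.map (𝟙 Y)) b rfl ?_ ?_
  · change b ≫ pbFst s.map (𝟙 Y) ≫ s.ι = s.ι
    rw [reassoc_of% b₁]
  · change pbFst s.map (𝟙 Y) ≫ s.map ≫ f = pbSnd s.map (𝟙 Y) ≫ f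
    rw [← Category.assoc, hp.w, Category.comp_id]

lemma mono_tot (f : X ⟶ Y) [Mono f] {F G : PaPreOrd.mk Z ⟶ PaPreOrd.mk X}
    (h : F ≫ tot f = G ≫ tot f) : F = G := by
  obtain ⟨s, rfl⟩ := PartialMap.exists_toHom_eq F
  obtain ⟨t, rfl⟩ := PartialMap.exists_toHom_eq G
  rw [toHom_comp_tot, toHom_comp_tot, PartialMap.toHom_eq_iff] at h
  obtain ⟨(e : s.dom ≅ t.dom), (h₁ : e.hom ≫ t.ι = s.ι),
    (h₂ : e.hom ≫ t.map ≫ f = s.map ≫ f)⟩ := h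
  refine PartialMap.toHom_eq_iff.2 ⟨e, h₁, ?_⟩
  rwa [← cancel_mono f, Category.assoc]

lemma isZKernel_isTrivialPartial {f : X ⟶ Y} {g : Y ⟶ Z} (h : IsZKernel (isTrivial C) f g)
    {F : PaPreOrd.mk W ⟶ PaPreOrd.mk X} (hF : IsTrivialPartial (F ≫ tot f)) :
    IsTrivialPartial F := by
  obtain ⟨s, rfl⟩ := PartialMap.exists_toHom_eq F
  rw [toHom_comp_tot, isTrivialPartial_toHom_iff] at hF
  exact (isTrivialPartial_toHom_iff s).2 (h.trivial_of_comp hF)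

/-- A decomposition of the middle term of a short exact sequence induces one of the cokernel: it is
classified by a morphism to the coproduct of two points, which factors through the cokernel as all
morphisms into a discrete preorder are trivial. -/
lemma exists_isDecomp_of_isZCokernel {E N : InternalPreorder C} {f : X ⟶ Y} {g : Y ⟶ Z}
    (h : IsZCokernel (isTrivial C) f g) {e : E ⟶ Y} {n : N ⟶ Y} (hd : IsDecomp e n) :
    ∃ (E' N' : InternalPreorder C) (e' : E' ⟶ Z) (n' : N' ⟶ Z) (a : E ⟶ E') (b : N ⟶ N'),
      IsDecomp e' n' ∧ a ≫ e' = e ≫ g ∧ b ≫ n' = n ≫ g := by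
  obtain ⟨χ, χ₁, χ₂⟩ := hd.exists_desc (toPoint E ≫ just (point C)) (toPoint N ≫ nothing (point C))
  have hχ : IsTrivialMor (isTrivial C) χ := by
    refine hd.isTrivialMor ?_ ?_
    · rw [χ₁]
      exact ⟨point C, _, _, isTrivial_discrete _, rfl⟩
    · rw [χ₂]
      exact ⟨point C, _, _, isTrivial_discrete _, rfl⟩
  obtain ⟨χ', hχ', -⟩ := h.2 χ (hχ.comp_left f)
  obtain ⟨a, ha, -⟩ := (pb_isPullback χ' (just (point C))).exists_lift (e ≫ g) (toPoint E)
    (by rw [Category.assoc, hχ', χ₁])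
  obtain ⟨b, hb, -⟩ := (pb_isPullback χ' (nothing (point C))).exists_lift (n ≫ g) (toPoint N)
    (by rw [Category.assoc, hχ', χ₂])
  exact ⟨_, _, _, _, a, b, (isDecomp_maybe (point C)).pbFst χ', ha, hb⟩

/-- A `Z`-cokernel remains epimorphic in the stable category. -/
lemma stableEq_of_isZCokernel {f : X ⟶ Y} {g : Y ⟶ Z} (h : IsZCokernel (isTrivial C) f g)
    {F G : PaPreOrd.mk Z ⟶ PaPreOrd.mk W} (hFG : StableEq (tot g ≫ F) (tot g ≫ G)) :
    StableEq F G := by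
  obtain ⟨E, N, e, n, hd, he, h₁, h₂⟩ := hFG
  obtain ⟨E', N', e', n', a, b, hd', ha, hb⟩ := exists_isDecomp_of_isZCokernel h hd
  obtain ⟨p, rfl⟩ := exists_ofMaybe_eq F
  obtain ⟨q, rfl⟩ := exists_ofMaybe_eq G
  have hepi := h.epi
  have triv : ∀ r : Z ⟶ maybe W, IsTrivialPartial (tot n ≫ tot g ≫ ofMaybe r) →
      IsTrivialPartial (tot n' ≫ ofMaybe r) := fun r hr => by
    rw [tot_comp_ofMaybe, tot_comp_ofMaybe, isTrivialPartial_ofMaybe_iff] at hr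
    rw [tot_comp_ofMaybe, isTrivialPartial_ofMaybe_iff]
    -- The restriction of `r` to `N'`, extended to `Z` by a constant, becomes trivial along `g`.
    obtain ⟨r', r₁, r₂⟩ := hd'.exists_desc (toPoint E' ≫ nothing W) (n' ≫ r)
    rw [← r₂]
    refine (h.trivial_of_comp (hd.isTrivialMor ?_ ?_)).comp_left n'
    · rw [← reassoc_of% ha, r₁, ← Category.assoc]
      exact isTrivialMor_comp_nothing _
    · rwa [← reassoc_of% hb, r₂, reassoc_of% hb]
  refine ⟨E', N', e', n', hd', ?_, triv p h₁, triv q h₂⟩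
  simp only [tot_comp_ofMaybe] at he
  have he := ofMaybe_injective he
  rw [tot_comp_ofMaybe, tot_comp_ofMaybe]
  obtain ⟨q', q₁, q₂⟩ := hd'.exists_desc (e' ≫ q) (n' ≫ p)
  have hpq : p = q' := by
    rw [← cancel_epi g]
    refine hd.hom_ext ?_ ?_
    · rw [← reassoc_of% ha, ← reassoc_of% ha, q₁, reassoc_of% ha, reassoc_of% ha, he]
    · rw [← reassoc_of% hb, ← reassoc_of% hb, q₂]
  rw [← q₁, hpq]

/-- The canonical functor to the stable category maps short exact sequences relative to the trivial
objects to short exact sequences. -/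
lemma isShortExactSeq_stabFunctor_map {f : X ⟶ Y} {g : Y ⟶ Z}
    (h : IsShortZExact (isTrivial C) f g) :
    IsShortExactSeq ((stabFunctor C).map f) ((stabFunctor C).map g) := by
  have hmono := h.1.mono
  rw [isShortExactSeq_iff]
  refine ⟨?_, ?_, ?_⟩
  · rw [← Functor.map_comp, stabFunctor_map_eq_zero_iff]
    exact h.1.1
  · intro W l hl
    obtain ⟨W, rfl⟩ := exists_stabFunctor_obj_eq W
    obtain ⟨F, rfl⟩ := exists_stab_eq l
    obtain ⟨s, rfl⟩ := PartialMap.exists_toHom_eq F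
    rw [← stab_tot, ← stab_comp, stab_eq_zero_iff, toHom_comp_tot, isTrivialPartial_toHom_iff] at hl
    obtain ⟨k, hk, -⟩ := h.1.2 s.map hl
    refine ⟨stab (PartialMap.mk s.dom s.ι k s.complemented).toHom, ?_, fun m hm => ?_⟩
    · beta_reduce
      rw [← stab_tot, ← stab_comp, toHom_comp_tot, hk]
    · obtain ⟨G, rfl⟩ := exists_stab_eq m
      rw [← stab_tot, ← stab_comp, stab_eq_iff] at hm
      obtain ⟨E, N, e, n, hd, he, h₁, h₂⟩ := hm
      refine (stab_eq_iff _ _).2 ⟨E, N, e, n, hd, mono_tot f ?_, ?_, ?_⟩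
      · rw [Category.assoc, he, Category.assoc, toHom_comp_tot, hk]
      · exact isZKernel_isTrivialPartial h.1 (by rwa [Category.assoc])
      · exact isZKernel_isTrivialPartial h.1 (by rwa [Category.assoc, toHom_comp_tot, hk])
  · intro W l hl
    obtain ⟨W, rfl⟩ := exists_stabFunctor_obj_eq W
    obtain ⟨F, rfl⟩ := exists_stab_eq l
    obtain ⟨p, rfl⟩ := exists_ofMaybe_eq F
    rw [← stab_tot, ← stab_comp, stab_eq_zero_iff, tot_comp_ofMaybe,
      isTrivialPartial_ofMaybe_iff] at hl
    obtain ⟨k, hk, -⟩ := h.2.2 p hl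
    refine ⟨stab (ofMaybe k), ?_, fun m hm => ?_⟩
    · beta_reduce
      rw [← stab_tot, ← stab_comp, tot_comp_ofMaybe, hk]
    · obtain ⟨G, rfl⟩ := exists_stab_eq m
      rw [← stab_tot, ← stab_comp, stab_eq_iff] at hm
      refine (stab_eq_iff _ _).2 (stableEq_of_isZCokernel h.2 ?_)
      rwa [tot_comp_ofMaybe, hk]

end StableTorsion

/-! ### The torsion theory of the stable category -/

section StableTorsionTheory

open InternalPreorder PaPreOrd

lemma InternalPreorder.IsDecomp.isEquivalence_left {C : Type u} [Category.{v} C] [HasPullbacks C]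
    [FinitaryExtensive C] {X Y Z : InternalPreorder C} {α : X ⟶ Z} {β : Y ⟶ Z}
    (h : IsDecomp α β) (hZ : isEquivalence C Z) : isEquivalence C X := by
  obtain ⟨σ, σ₁, σ₂⟩ := (isEquivalence_iff Z).1 hZ
  have hα := (coprod_mono h.1).1
  have hp := ((extensive_iff h.1 X.p₁ Y.p₁ Z.p₁ α.comm₁.symm β.comm₁.symm).1 h.2).1
  obtain ⟨r, r₁, r₂⟩ := hp.exists_lift (α.mapRel ≫ σ) X.p₂
    (by rw [Category.assoc, σ₁, α.comm₂])
  refine (isEquivalence_iff X).2 ⟨r, r₂, ?_⟩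
  rw [← cancel_mono α.map, Category.assoc, ← α.comm₂, reassoc_of% r₁, σ₂, α.comm₁]

variable {C : Type u} [Category.{v} C]

lemma stabFunctor_eq_zero [HasFiniteLimits C] [FinitaryExtensive C] {X Y : InternalPreorder C}
    (f : (stabFunctor C).obj X ⟶ (stabFunctor C).obj Y) (hX : isEquivalence C X)
    (hY : isPartialOrder C Y) : f = 0 := by
  obtain ⟨F, rfl⟩ := exists_stab_eq f
  obtain ⟨s, rfl⟩ := PartialMap.exists_toHom_eq F
  obtain ⟨D, β, hs⟩ := s.complemented
  rw [stab_eq_zero_iff, isTrivialPartial_toHom_iff]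
  exact isTrivialMor_of_isEquivalence_of_isPartialOrder _
    ((isComplement_iff.1 hs).isEquivalence_left hX) hY

variable [Pretopos C]

/-- The torsion theory of the stable category. Its two classes are closed under stable isomorphism,
as a preorder is an equivalence relation (a partial order) once the second (first) morphism of its
canonical sequence vanishes stably. -/
lemma isTorsionTheory_stab : IsTorsionTheory (stabProperty (isEquivalence C))
    (stabProperty (isPartialOrder C)) where
  replete_torsion := by
    refine ⟨?_⟩
    intro X Y i hX
    obtain ⟨X, rfl⟩ := exists_stabFunctor_obj_eq X
    obtain ⟨Y, rfl⟩ := exists_stabFunctor_obj_eq Y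
    change isEquivalence C X at hX
    change isEquivalence C Y
    obtain ⟨Y₁, Y₂, f, g, h₁, h₂, h⟩ :=
      (isPretorsionTheory_isEquivalence_isPartialOrder (C := C)).exact_seq Y
    -- The quotient `g` vanishes stably, so it is trivial and its kernel `f` is invertible.
    have hg : (stabFunctor C).map g = 0 := by
      rw [← cancel_epi i.hom, comp_zero]
      exact stabFunctor_eq_zero _ hX h₂
    rw [stabFunctor_map_eq_zero_iff] at hg
    obtain ⟨s, hs, -⟩ := h.1.2 (𝟙 Y) (by rwa [Category.id_comp])
    have := h.1.mono
    exact isEquivalence_of_iso ⟨f, s, by rw [← cancel_mono f, Category.assoc, hs]; simp, hs⟩ h₁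
  replete_torsionFree := by
    refine ⟨?_⟩
    intro X Y i hX
    obtain ⟨X, rfl⟩ := exists_stabFunctor_obj_eq X
    obtain ⟨Y, rfl⟩ := exists_stabFunctor_obj_eq Y
    change isPartialOrder C X at hX
    change isPartialOrder C Y
    obtain ⟨Y₁, Y₂, f, g, h₁, h₂, h⟩ :=
      (isPretorsionTheory_isEquivalence_isPartialOrder (C := C)).exact_seq Y
    -- The inclusion `f` vanishes stably, so it is trivial and its cokernel `g` is invertible.
    have hf : (stabFunctor C).map f = 0 := by
      rw [← cancel_mono i.inv, zero_comp]
      exact stabFunctor_eq_zero _ h₁ hX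
    rw [stabFunctor_map_eq_zero_iff] at hf
    obtain ⟨s, hs, -⟩ := h.2.2 (𝟙 Y) (by rwa [Category.comp_id])
    have := h.2.epi
    exact isPartialOrder_of_iso ⟨s, g, by rw [← cancel_epi g, ← Category.assoc, hs]; simp, hs⟩ h₂
  zero := fun ⟨⟨X⟩⟩ ⟨⟨Y⟩⟩ f hX hY => stabFunctor_eq_zero (X := X) (Y := Y) f hX hY
  exact_seq := by
    rintro ⟨⟨X⟩⟩
    obtain ⟨X₁, X₂, f, g, h₁, h₂, h⟩ :=
      (isPretorsionTheory_isEquivalence_isPartialOrder (C := C)).exact_seq X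
    exact ⟨_, _, (stabFunctor C).map f, (stabFunctor C).map g, h₁, h₂,
      isShortExactSeq_stabFunctor_map h⟩

lemma isTorsionTheoryFunctor_stabFunctor :
    IsTorsionTheoryFunctor (isEquivalence C) (isPartialOrder C) (stabProperty (isEquivalence C))
      (stabProperty (isPartialOrder C)) (stabFunctor C) where
  map_torsion _ h := h
  map_torsionFree _ h := h
  map_exact _ _ _ _ _ _ _ h := isShortExactSeq_stabFunctor_map h

end StableTorsionTheory

/-! ### Extension of functors to the stable category -/

section UniversalProperty

open InternalPreorder PaPreOrd

variable {C : Type u} [Category.{v} C] [HasFiniteLimits C] [FinitaryExtensive C]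
  {B : Type u₂} [Category.{v₂} B] [HasZeroMorphisms B]
  (G : InternalPreorder C ⥤ B) [PreservesFiniteCoproducts G] {X Y Z : InternalPreorder C}

lemma isColimit_map_of_isDecomp {α : X ⟶ Z} {β : Y ⟶ Z} (h : IsDecomp α β) :
    Nonempty (IsColimit (BinaryCofan.mk (G.map α) (G.map β))) :=
  ⟨mapIsColimitOfPreservesOfIsColimit G α β h.isColimit.some⟩

lemma map_hom_ext_of_isDecomp {α : X ⟶ Z} {β : Y ⟶ Z} (h : IsDecomp α β) {V : B}
    {f g : G.obj Z ⟶ V} (h₁ : G.map α ≫ f = G.map α ≫ g) (h₂ : G.map β ≫ f = G.map β ≫ g) :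
    f = g :=
  BinaryCofan.IsColimit.hom_ext (isColimit_map_of_isDecomp G h).some h₁ h₂

/-- The value of the extension of `G` at the partial inverse of `just Y`: the identity on `G.obj Y`
and zero on the image of the added point. -/
noncomputable def mapUnjust (Y : InternalPreorder C) : G.obj (maybe Y) ⟶ G.obj Y :=
  (BinaryCofan.IsColimit.desc' (isColimit_map_of_isDecomp G (isDecomp_maybe Y)).some (𝟙 _) 0).1

lemma map_just_comp_mapUnjust (Y : InternalPreorder C) : G.map (just Y) ≫ mapUnjust G Y = 𝟙 _ :=
  (BinaryCofan.IsColimit.desc' (isColimit_map_of_isDecomp G (isDecomp_maybe Y)).some (𝟙 _) 0).2.1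

lemma map_nothing_comp_mapUnjust (Y : InternalPreorder C) :
    G.map (nothing Y) ≫ mapUnjust G Y = 0 :=
  (BinaryCofan.IsColimit.desc' (isColimit_map_of_isDecomp G (isDecomp_maybe Y)).some (𝟙 _) 0).2.2

/-- The action on partial morphisms of the extension of `G`. -/
noncomputable def mapPartial (F : PaPreOrd.mk X ⟶ PaPreOrd.mk Y) : G.obj X ⟶ G.obj Y :=
  G.map (exists_ofMaybe_eq F).choose ≫ mapUnjust G Y

lemma mapPartial_ofMaybe (h : X ⟶ maybe Y) :
    mapPartial G (ofMaybe h) = G.map h ≫ mapUnjust G Y := by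
  rw [mapPartial, ofMaybe_injective (exists_ofMaybe_eq (ofMaybe h)).choose_spec]

lemma mapPartial_tot (f : X ⟶ Y) : mapPartial G (tot f) = G.map f := by
  rw [tot_eq_ofMaybe, mapPartial_ofMaybe, G.map_comp, Category.assoc, map_just_comp_mapUnjust,
    Category.comp_id]

lemma mapPartial_comp (F : PaPreOrd.mk X ⟶ PaPreOrd.mk Y) (F' : PaPreOrd.mk Y ⟶ PaPreOrd.mk Z) :
    mapPartial G (F ≫ F') = mapPartial G F ≫ mapPartial G F' := by
  obtain ⟨h, rfl⟩ := exists_ofMaybe_eq F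
  obtain ⟨k, rfl⟩ := exists_ofMaybe_eq F'
  obtain ⟨b, b₁, b₂⟩ := exists_bind k
  rw [ofMaybe_comp_ofMaybe h b₁ b₂, mapPartial_ofMaybe, mapPartial_ofMaybe, mapPartial_ofMaybe,
    G.map_comp, Category.assoc, Category.assoc]
  refine congrArg (G.map h ≫ ·) (map_hom_ext_of_isDecomp G (isDecomp_maybe Y) ?_ ?_)
  · rw [← Category.assoc, ← G.map_comp, b₁, ← Category.assoc, map_just_comp_mapUnjust,
      Category.id_comp]
  · rw [← Category.assoc, ← G.map_comp, b₂, map_nothing_comp_mapUnjust, ← Category.assoc,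
      map_nothing_comp_mapUnjust, zero_comp]

/-- The extension to partial morphisms of a functor that preserves finite coproducts. -/
noncomputable def paExtension : PaPreOrd C ⥤ B where
  obj X := G.obj X.as
  map {X Y} F := mapPartial G (X := X.as) (Y := Y.as) F
  map_id X := (mapPartial_tot G (𝟙 X.as)).trans (G.map_id _)
  map_comp F F' := mapPartial_comp G F F'

lemma mapPartial_eq_of_stableEq
    (hG : ∀ ⦃X Y : InternalPreorder C⦄ (f : X ⟶ Y), IsTrivialMor (isTrivial C) f → G.map f = 0)
    {F F' : PaPreOrd.mk X ⟶ PaPreOrd.mk Y} (h : StableEq F F') :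
    mapPartial G F = mapPartial G F' := by
  have triv : ∀ {N : InternalPreorder C} (n : N ⟶ X) (K : PaPreOrd.mk X ⟶ PaPreOrd.mk Y),
      IsTrivialPartial (tot n ≫ K) → G.map n ≫ mapPartial G K = 0 := fun {N} n K hK => by
    obtain ⟨k, rfl⟩ := exists_ofMaybe_eq K
    rw [tot_comp_ofMaybe, isTrivialPartial_ofMaybe_iff] at hK
    rw [mapPartial_ofMaybe, ← Category.assoc, ← G.map_comp, hG _ hK, zero_comp]
  obtain ⟨E, N, e, n, hd, he, h₁, h₂⟩ := h
  refine map_hom_ext_of_isDecomp G hd ?_ ((triv n F h₁).trans (triv n F' h₂).symm)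
  rw [← mapPartial_tot G e, ← mapPartial_comp, ← mapPartial_comp, he]

/-- The extension to the stable category of a functor that preserves finite coproducts and sends
trivial morphisms to zero. -/
noncomputable def stabExtension
    (hG : ∀ ⦃X Y : InternalPreorder C⦄ (f : X ⟶ Y), IsTrivialMor (isTrivial C) f → G.map f = 0) :
    Stab C ⥤ B :=
  CategoryTheory.Quotient.lift (stableRel C) (paExtension G) fun X Y F F' h =>
    mapPartial_eq_of_stableEq G hG ((stableRel_iff (X := X.as) (Y := Y.as) F F').1 h)

variable (hG : ∀ ⦃X Y : InternalPreorder C⦄ (f : X ⟶ Y),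
  IsTrivialMor (isTrivial C) f → G.map f = 0)

lemma stabExtension_map_stabFunctor_map (f : X ⟶ Y) :
    (stabExtension G hG).map ((stabFunctor C).map f) = G.map f := mapPartial_tot G f

lemma stabFunctor_comp_stabExtension : stabFunctor C ⋙ stabExtension G hG = G :=
  CategoryTheory.Functor.ext (fun _ => rfl) fun X Y f => by
    -- The objects agree definitionally, so the transport morphisms are identities.
    erw [Category.id_comp, Category.comp_id]
    exact stabExtension_map_stabFunctor_map G hG f

lemma isZero_obj_initial [HasZeroObject B] : IsZero (G.obj (discrete (⊥_ C))) :=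
  (isZero_zero B).of_iso ((IsInitial.isInitialObj G _ isInitial_discrete_initial.some).uniqueUpToIso
    HasZeroObject.zeroIsInitial)

lemma preservesFiniteCoproducts_stabExtension [HasZeroObject B] :
    PreservesFiniteCoproducts (stabExtension G hG) := by
  refine preservesFiniteCoproducts_of_cocones _ isZero_stab.isInitial
    (isZero_obj_initial G).isInitial fun X Y => ?_
  obtain ⟨X, rfl⟩ := exists_stabFunctor_obj_eq X
  obtain ⟨Y, rfl⟩ := exists_stabFunctor_obj_eq Y
  refine ⟨_, (stabFunctor C).map (sumInl X Y), (stabFunctor C).map (sumInr X Y),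
    isColimit_stabFunctor_map (isDecomp_sum X Y), ?_⟩
  rw [stabExtension_map_stabFunctor_map, stabExtension_map_stabFunctor_map]
  exact isColimit_map_of_isDecomp G (isDecomp_sum X Y)

/-- The extension to the stable category is unique: a partial morphism is a total morphism into
`maybe Y` followed by the partial inverse of `just Y`, and the value at the latter is determined on
the two summands of `maybe Y`. -/
lemma eq_stabExtension [HasZeroObject B] (H : Stab C ⥤ B) (hH : stabFunctor C ⋙ H = G) :
    H = stabExtension G hG := by
  subst hH
  refine CategoryTheory.Quotient.lift_unique _ _ _ H
    (CategoryTheory.Functor.ext (fun _ => rfl) fun X Y F => ?_)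
  obtain ⟨h, rfl⟩ := exists_ofMaybe_eq (X := X.as) (Y := Y.as) F
  have hnull : ∀ X Y : InternalPreorder C, H.map (stab (null X Y)) = 0 := fun X Y => by
    rw [← null_comp (null (discrete (⊥_ C)) Y), stab_comp, H.map_comp,
      (isZero_obj_initial (stabFunctor C ⋙ H)).eq_zero_of_tgt (H.map (stab (null X _))), zero_comp]
  have hu : H.map (stab (unjust Y.as)) = mapUnjust (stabFunctor C ⋙ H) Y.as := by
    refine map_hom_ext_of_isDecomp (stabFunctor C ⋙ H) (isDecomp_maybe Y.as) ?_ ?_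
    · rw [map_just_comp_mapUnjust, Functor.comp_map, ← stab_tot, ← H.map_comp, ← stab_comp,
        tot_just_comp_unjust, stab_id, H.map_id]
      rfl
    · rw [map_nothing_comp_mapUnjust, Functor.comp_map, ← stab_tot, ← H.map_comp, ← stab_comp,
        tot_nothing_comp_unjust]
      exact hnull _ _
  have key : H.map (stab (ofMaybe h)) = mapPartial (stabFunctor C ⋙ H) (ofMaybe h) := by
    rw [mapPartial_ofMaybe, ← hu, ofMaybe, stab_comp, H.map_comp]
    rfl
  erw [Category.id_comp, Category.comp_id]
  exact key

end UniversalProperty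

section Main

open InternalPreorder PaPreOrd

lemma isShortZExact_iff_isShortExactSeq {A : Type u₁} [Category.{v₁} A] [HasZeroMorphisms A]
    {P : ObjectProperty A} (hP : ∀ ⦃X Y : A⦄ (f : X ⟶ Y), IsTrivialMor P f ↔ f = 0) {X Y W : A}
    {f : X ⟶ Y} {g : Y ⟶ W} : IsShortZExact P f g ↔ IsShortExactSeq f g := by
  rw [isShortExactSeq_iff]
  simp only [IsShortZExact, IsZKernel, IsZCokernel, hP]
  tauto

variable {C : Type u} [Category.{v} C] [Pretopos C]

lemma isTrivialMor_stab_iff {X Y : Stab C} (f : X ⟶ Y) :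
    IsTrivialMor (stabProperty (isEquivalence C) ⊓ stabProperty (isPartialOrder C)) f ↔ f = 0 := by
  constructor
  · rintro ⟨W, a, b, hW, rfl⟩
    rw [← Category.id_comp b, isTorsionTheory_stab.zero (𝟙 W) hW.1 hW.2, zero_comp, comp_zero]
  · rintro rfl
    exact ⟨(stabFunctor C).obj (discrete (⊥_ C)), 0, 0,
      ⟨isEquivalence_discrete _, isPartialOrder_discrete _⟩, zero_comp⟩

variable {B : Type u₂} [Category.{v₂} B] [HasZeroObject B] [HasZeroMorphisms B]
  {T F : ObjectProperty B} {G : InternalPreorder C ⥤ B}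

lemma map_eq_zero_of_isTorsionTheoryFunctor (h : IsTorsionTheory T F)
    (hG : IsTorsionTheoryFunctor (isEquivalence C) (isPartialOrder C) T F G)
    {X Y : InternalPreorder C} (f : X ⟶ Y) (hf : IsTrivialMor (isTrivial C) f) : G.map f = 0 := by
  obtain ⟨W, a, b, hW, rfl⟩ := hf
  rw [G.map_comp, ← Category.id_comp (G.map b),
    h.zero (𝟙 (G.obj W)) (hG.map_torsion _ hW.1) (hG.map_torsionFree _ hW.2), zero_comp, comp_zero]

/-- A functor on the stable category is a torsion theory functor if its restriction to preorders
is: every canonical sequence in the stable category is isomorphic to the image of one of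
preorders. -/
lemma isTorsionTheoryFunctor_stabExtension [PreservesFiniteCoproducts G]
    (hG : IsTorsionTheoryFunctor (isEquivalence C) (isPartialOrder C) T F G)
    (hz : ∀ ⦃X Y : InternalPreorder C⦄ (f : X ⟶ Y), IsTrivialMor (isTrivial C) f → G.map f = 0) :
    IsTorsionTheoryFunctor (stabProperty (isEquivalence C)) (stabProperty (isPartialOrder C)) T F
      (stabExtension G hz) where
  map_torsion X hX := hG.map_torsion X.as.as hX
  map_torsionFree X hX := hG.map_torsionFree X.as.as hX
  map_exact := by
    intro X₁ X X₂ f g h₁ h₂ h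
    obtain ⟨X, rfl⟩ := exists_stabFunctor_obj_eq X
    obtain ⟨Y₁, Y₂, f', g', h₁', h₂', h'⟩ :=
      (isPretorsionTheory_isEquivalence_isPartialOrder (C := C)).exact_seq X
    have hs := (isShortZExact_iff_isShortExactSeq fun _ _ f => isTrivialMor_stab_iff f).2
      (isShortExactSeq_stabFunctor_map h')
    obtain ⟨a, b, rfl, hb⟩ := IsShortZExact.exists_iso
      (fun X Y f hX hY => (isTrivialMor_stab_iff f).2 (isTorsionTheory_stab.zero f hX hY))
      h hs h₁ h₂ h₁' h₂'
    obtain rfl : g = (stabFunctor C).map g' ≫ b.inv := by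
      rw [← hb, Category.assoc, b.hom_inv_id, Category.comp_id]
    rw [Functor.map_comp, Functor.map_comp, stabExtension_map_stabFunctor_map,
      stabExtension_map_stabFunctor_map]
    exact (hG.map_exact f' g' h₁' h₂' h').of_iso ((stabExtension G hz).mapIso a)
      ((stabExtension G hz).mapIso b.symm)

end Main

theorem mainTheorem1 {C : Type u} [Category.{v} C] [Pretopos C] :
    -- `(Eq(C), ParOrd(C))` is a pretorsion theory in `PreOrd(C)`
    IsPretorsionTheory (InternalPreorder.isEquivalence C) (InternalPreorder.isPartialOrder C) ∧
    -- the pointed category `Stab(C)` has finite coproducts and a torsion theory, and the canonical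
    -- functor is a torsion theory functor preserving finite coproducts
    HasFiniteCoproducts (Stab C) ∧
    IsTorsionTheory (stabProperty (InternalPreorder.isEquivalence C))
      (stabProperty (InternalPreorder.isPartialOrder C)) ∧
    IsTorsionTheoryFunctor (InternalPreorder.isEquivalence C) (InternalPreorder.isPartialOrder C)
      (stabProperty (InternalPreorder.isEquivalence C))
      (stabProperty (InternalPreorder.isPartialOrder C)) (stabFunctor C) ∧
    PreservesFiniteCoproducts (stabFunctor C) ∧
    -- the universal property
    ∀ {X : Type u₂} [Category.{v₂} X] [HasZeroObject X] [HasZeroMorphisms X]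
      [HasFiniteCoproducts X] (T F : ObjectProperty X), IsTorsionTheory T F →
      ∀ G : InternalPreorder C ⥤ X, PreservesFiniteCoproducts G →
        IsTorsionTheoryFunctor (InternalPreorder.isEquivalence C)
          (InternalPreorder.isPartialOrder C) T F G →
        ∃ G' : Stab C ⥤ X, stabFunctor C ⋙ G' = G ∧
          (∀ H : Stab C ⥤ X, stabFunctor C ⋙ H = G → H = G') ∧
          PreservesFiniteCoproducts G' ∧
          IsTorsionTheoryFunctor (stabProperty (InternalPreorder.isEquivalence C))
            (stabProperty (InternalPreorder.isPartialOrder C)) T F G' := by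
  refine ⟨InternalPreorder.isPretorsionTheory_isEquivalence_isPartialOrder,
    hasFiniteCoproducts_stab, isTorsionTheory_stab, isTorsionTheoryFunctor_stabFunctor,
    preservesFiniteCoproducts_stabFunctor, ?_⟩
  intro X _ _ _ _ T F hT G _ hG
  have hz := fun ⦃X Y⦄ (f : X ⟶ Y) => map_eq_zero_of_isTorsionTheoryFunctor hT hG f
  exact ⟨stabExtension G hz, stabFunctor_comp_stabExtension G hz,
    fun H hH => eq_stabExtension G hz H hH, preservesFiniteCoproducts_stabExtension G hz,
    isTorsionTheoryFunctor_stabExtension hG hz⟩
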